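/- Notation. Let $d\ge 1$, let $\|\cdot\|$ be the Euclidean norm and $\mu$ the Lebesgue measure on $[0,1]^d$. For $\alpha>0$ let $s$ be the largest integer strictly less than $\alpha$ and $\delta=\alpha-s\in(0,1]$. The Hölder ball $\mathcal H^{\alpha}([0,1]^d,H)$ consists of the functions $f:[0,1]^d\to\mathbb R^m$ with continuous partial derivatives up to order $s$ such that $|D^{\gamma}f_i(x)|\le H$ for all $i$, all $x\in[0,1]^d$ and all $|\gamma|\le s$, and $|D^{\gamma}f_i(x)-D^{\gamma}f_i(y)|\le H\min\{1,\|x-y\|\}^{\delta}$ for all $i$, all $x,y\in[0,1]^d$ and all $|\gamma|=s$. For $\Lambda>1$ let $\mathcal H^{\alpha}_\Lambda([0,1]^d,H)$ be the set of those $f\in\mathcal H^\alpha([0,1]^d,H)$ with $m=d$ and $\Lambda^{-2}I\preceq\nabla f(x)^\top\nabla f(x)\preceq\Lambda^2 I$ for all $x\in[0,1]^d$. For $\beta>2$, $\Lambda>1$, $H^*>1$ let $\mathcal P(\beta,\Lambda,H^*)$ be the class of probability densities on $[0,1]^d$ of the form $$p^*(x)=\bigl|\det\nabla g\bigl(g^{-1}(x)\bigr)\bigr|^{-1},\qquad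 x\in[0,1]^d,$$ where $g:[0,1]^d\to[0,1]^d$ is a bijection with $g\in\mathcal H^{1+\beta}_\Lambda([0,1]^d,H^*)$ (so $p^*$ is the density of $g(Y)$ for $Y$ uniform on $[0,1]^d$). For probability densities $p,q$ on $[0,1]^d$ let $$\mathrm{JS}(p,q)=\tfrac12\mathrm{KL}\bigl(p,\tfrac{p+q}2\bigr)+\tfrac12\mathrm{KL}\bigl(q,\tfrac{p+q}2\bigr),\qquad \mathrm{KL}(p,q)=\int p\log\frac pq\,d\mu .$$ Theorem. For every $d\ge1$ and $\Lambda>1$ there is a constant $c>0$, depending only on $d$ and $\Lambda$, such that for every $\beta>2$ and $H^*>1$ there is $n_0$ (depending on $d,\Lambda,\beta,H^*$) such that for every $n\ge n_0$ and every density estimator $\hat p$ based on $n$ observations (a measurable function of $X_1,\dots,X_n\in[0,1]^d$ whose values are probability densities on $[0,1]^d$), $$\sup_{p^*\in\mathcal P(\beta,\Lambda,H^*)}\mathsf E\,\mathrm{JS}\bigl(\hat p(X_1,\dots,X_n),p^*\bigr)\ \ge\ c\,n^{-2\beta/(2\beta+d)},$$ where $X_1,\dots,X_n$ are i.i.d.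 with density $p^*$. -/

import Mathlib

open MeasureTheory Set
open scoped ENNReal

noncomputable section

/-- The unit cube `[0, 1]^d` in Euclidean space. -/
def unitCube (d : ℕ) : Set (EuclideanSpace ℝ (Fin d)) :=
  {x | ∀ i, x i ∈ Set.Icc (0 : ℝ) 1}

/-- The partial derivative `∂^k f_i / ∂x_{ι 0} ⋯ ∂x_{ι (k-1)}` at `x`, taken within `Ω`.
As `ι` runs through all maps `Fin k → Fin d`, this runs through all `D^γ f_i` with `|γ| = k`. -/
def partialDeriv {d m : ℕ} (Ω : Set (EuclideanSpace ℝ (Fin d)))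
    (f : EuclideanSpace ℝ (Fin d) → EuclideanSpace ℝ (Fin m))
    {k : ℕ} (ι : Fin k → Fin d) (i : Fin m) (x : EuclideanSpace ℝ (Fin d)) : ℝ :=
  (iteratedFDerivWithin ℝ k f Ω x (fun j => EuclideanSpace.single (ι j) (1 : ℝ))) i

/-- The largest integer strictly less than `α` (for `α > 0`). -/
def strictFloor (α : ℝ) : ℕ := ⌈α⌉₊ - 1

/-- The Hölder ball `ℋ^α(Ω, H)`: with `s` the largest integer strictly less than `α` and
`δ = α - s ∈ (0, 1]`, the functions in `C^s(Ω)` all of whose partial derivatives of order at most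
`s` are bounded by `H`, and whose partial derivatives of order `s` satisfy
`|D^γ f_i(x) - D^γ f_i(y)| ≤ H * min(1, ‖x - y‖)^δ`. -/
def holderBall {d m : ℕ} (α : ℝ) (Ω : Set (EuclideanSpace ℝ (Fin d))) (H : ℝ) :
    Set (EuclideanSpace ℝ (Fin d) → EuclideanSpace ℝ (Fin m)) :=
  {f | ContDiffOn ℝ (strictFloor α) f Ω ∧
    (∀ k ≤ strictFloor α, ∀ ι : Fin k → Fin d, ∀ i, ∀ x ∈ Ω, |partialDeriv Ω f ι i x| ≤ H) ∧
    (∀ ι : Fin (strictFloor α) → Fin d, ∀ i, ∀ x ∈ Ω, ∀ y ∈ Ω,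
      |partialDeriv Ω f ι i x - partialDeriv Ω f ι i y| ≤
        H * (min 1 ‖x - y‖) ^ (α - (strictFloor α : ℝ)))}

/-- The class `ℋ^α_Λ(Ω, H)` of `Λ`-regular functions in the Hölder ball: for all `x ∈ Ω`,
`Λ⁻² I ⪯ ∇f(x)ᵀ ∇f(x) ⪯ Λ² I`, where `uᵀ ∇f(x)ᵀ ∇f(x) u = ‖∇f(x) u‖²`. -/
def regularHolderBall {d : ℕ} (α : ℝ) (Λ : ℝ) (Ω : Set (EuclideanSpace ℝ (Fin d))) (H : ℝ) :
    Set (EuclideanSpace ℝ (Fin d) → EuclideanSpace ℝ (Fin d)) :=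
  {f | f ∈ holderBall α Ω H ∧
    ∀ x ∈ Ω, ∀ u : EuclideanSpace ℝ (Fin d),
      Λ⁻¹ ^ 2 * ‖u‖ ^ 2 ≤ ‖fderivWithin ℝ f Ω x u‖ ^ 2 ∧
      ‖fderivWithin ℝ f Ω x u‖ ^ 2 ≤ Λ ^ 2 * ‖u‖ ^ 2}

/-- The densities `p` on `[0, 1]^d` of the form `p(x) = |det ∇g(g⁻¹(x))|⁻¹`, where
`g : [0, 1]^d → [0, 1]^d` is a bijection in `ℋ^{1+β}_Λ([0, 1]^d, H)`. (Only the values of `p` and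
`g` on the cube matter; the formula is written at `x = g y`.) -/
def smoothTransportDensities (d : ℕ) (β Λ H : ℝ) : Set (EuclideanSpace ℝ (Fin d) → ℝ) :=
  {p | ∃ g ∈ regularHolderBall (1 + β) Λ (unitCube d) H,
    Set.BijOn g (unitCube d) (unitCube d) ∧
    ∀ y ∈ unitCube d, p (g y) = |(fderivWithin ℝ g (unitCube d) y).det|⁻¹}

/-- The measure on `[0, 1]^d` with Lebesgue density `p`. -/
def densityMeasure {d : ℕ} (p : EuclideanSpace ℝ (Fin d) → ℝ) :
    Measure (EuclideanSpace ℝ (Fin d)) :=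
  (volume.restrict (unitCube d)).withDensity (fun x => ENNReal.ofReal (p x))

/-- `p` is a probability density on `[0, 1]^d` (the integral being `1`, `p` is integrable). -/
def IsCubeDensity {d : ℕ} (p : EuclideanSpace ℝ (Fin d) → ℝ) : Prop :=
  (∀ x ∈ unitCube d, 0 ≤ p x) ∧ ∫ x in unitCube d, p x = 1

/-- The Kullback-Leibler divergence between the distributions on `[0, 1]^d` with densities
`p` and `q`. -/
def klDensity {d : ℕ} (p q : EuclideanSpace ℝ (Fin d) → ℝ) : ℝ≥0∞ :=
  InformationTheory.klDiv (densityMeasure p) (densityMeasure q)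

/-- The Jensen-Shannon divergence between the distributions on `[0, 1]^d` with densities
`p` and `q`. -/
def jsDensity {d : ℕ} (p q : EuclideanSpace ℝ (Fin d) → ℝ) : ℝ≥0∞ :=
  2⁻¹ * klDensity p (fun x => (p x + q x) / 2) + 2⁻¹ * klDensity q (fun x => (p x + q x) / 2)

/-- A density estimator based on `n` observations in `[0, 1]^d`: a measurable function of the
observations (jointly with the point of evaluation) whose values are probability densities. -/
structure IsDensityEstimator {d n : ℕ}
    (phat : (Fin n → EuclideanSpace ℝ (Fin d)) → EuclideanSpace ℝ (Fin d) → ℝ) : Prop where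
  measurable : Measurable (Function.uncurry phat)
  isCubeDensity : ∀ X, (∀ k, X k ∈ unitCube d) → IsCubeDensity (phat X)

/-- The risk `E JS(p̂(X₁, …, X_n), p)` for `X₁, …, X_n` independent with density `p`. -/
def jsRisk {d n : ℕ}
    (phat : (Fin n → EuclideanSpace ℝ (Fin d)) → EuclideanSpace ℝ (Fin d) → ℝ)
    (p : EuclideanSpace ℝ (Fin d) → ℝ) : ℝ≥0∞ :=
  ∫⁻ X, jsDensity (phat X) p ∂(Measure.pi fun _ : Fin n => densityMeasure p)

end

/-! The bound is Assouad's method over a hypercube of shears `x ↦ x + u(x) e` of the cube, where `e`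
is a coordinate vector and `u` is `τ` times the sum of a subfamily of `M ^ d` waves of width about
`1 / N`, centred on a grid, with `N = 8 * M`. At the image of `y` the density is `1 / (1 + ∂u(y))`,
with `∂` the derivative along `e`, so to first order switching a wave `w` on changes the density by
`-τ ∂w`, of size at most `ρ = 4πNτ`. One switch costs a χ² divergence of order `ρ² N^(-d)` and
creates an L¹ separation of order `ρ N^(-d)` on the cell of that wave. With `N` of order
`n^(1/(2β+d))` and `ρ` of order `n^(-β/(2β+d))`, `n ρ² N^(-d)` stays small, so no switch can be read
off reliably from `n` observations. The errors on the disjoint cells add up to an L¹ error of order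
`ρ`, hence a Jensen-Shannon error of order `ρ²`.

The delicate point is that the constant may not depend on `β`, although derivatives up to order
about `1 + β` must be controlled. The waves are therefore not compactly supported bumps but
trigonometric polynomials of degree at most `N`: products of Fejér kernels, times a sine that
vanishes on the two faces orthogonal to `e`. M. Riesz's formula (`riesz_sum_sin`) writes the
derivative as a combination of translates with total weight at most `4πN`. So each further partial
derivative costs exactly one factor `4πN` (`PartialRieszFormula.iteratedFDeriv_single`), while the
Fejér partition of unity keeps `|u| ≤ τ` (`abs_sum_trigWave_le_one`). The Hölder condition then
follows from `2d (4πN)^(1+β) τ ≤ 1`, and choosing `4πN ≤ n^(1/(2β+d))` leaves no constant raised to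
the power `β`. The parameters `Λ` and `H` only ask that `ρ` be small, that is, that `n` be large.

The tails of the waves are harmless: only hypotheses differing by a single wave are compared, and
their separation is measured on the cell of that wave. The quadratic loss is linearised with a free
parameter `t` (`ofReal_mul_lintegral_abs_sub_le_jsDensity`), so that Assouad's lemma is applied to
the L¹ loss, which is additive over cells. -/

/-! ### The Fejér kernel and M. Riesz's interpolation formula. -/

/-- The Fejér kernel of order `N` and period `1`, normalised to take the value `1` at `0`. -/
noncomputable def fejer (N : ℕ) (t : ℝ) : ℝ :=
  (∑ a ∈ Finset.range N, ∑ b ∈ Finset.range N,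
    Real.cos (2 * Real.pi * ((a : ℝ) - b) * t)) / (N : ℝ) ^ 2

/-- The nodes of the interpolation formula of M. Riesz for derivatives of trigonometric
polynomials of period `1` and degree at most `N`. -/
noncomputable def rieszNode (N l : ℕ) : ℝ := (l : ℝ) / ((4 * N : ℕ) : ℝ)

/-- The coefficients of the interpolation formula of M. Riesz. -/
noncomputable def rieszCoeff (N l : ℕ) : ℝ :=
  Real.pi * N * Real.sin (2 * Real.pi * N * rieszNode N l) * fejer N (rieszNode N l)

/-- This is the real part of a geometric sum whose ratio is an `M`-th root of unity, different from
`1` because `M` does not divide `q`. -/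
theorem sum_cos_arith_eq_zero {M : ℕ} {q : ℤ} (hq : q ≠ 0) (hM : |q| < M) (θ : ℝ) :
    ∑ l ∈ Finset.range M, Real.cos (θ + 2 * Real.pi * q * ((l : ℝ) / M)) = 0 := by
  have hM0 : (M : ℂ) ≠ 0 := by
    have : (0 : ℤ) < M := lt_of_le_of_lt (abs_nonneg q) hM
    exact_mod_cast this.ne'
  set ζ : ℂ := Complex.exp (2 * Real.pi * Complex.I * (q / M)) with hζ
  have h1 : ζ ≠ 1 := by
    rw [hζ, Ne, Complex.exp_eq_one_iff]
    rintro ⟨n, hn⟩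
    have hpi : (2 * Real.pi * Complex.I : ℂ) ≠ 0 := Complex.two_pi_I_ne_zero
    have h2 : (q : ℂ) / M = n := by
      apply mul_left_cancel₀ hpi
      rw [hn]; ring
    rw [div_eq_iff hM0] at h2
    have h3 : q = n * M := by exact_mod_cast h2
    have h4 : (M : ℤ) ∣ q := ⟨n, by rw [h3]; ring⟩
    exact hq (Int.eq_zero_of_abs_lt_dvd h4 hM)
  have h2 : ζ ^ M = 1 := by
    rw [hζ, ← Complex.exp_nat_mul, Complex.exp_eq_one_iff]
    exact ⟨q, by field_simp⟩
  have h3 : ∑ l ∈ Finset.range M, ζ ^ l = 0 := by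
    rw [geom_sum_eq h1, h2]; simp
  have h4 : ∀ l : ℕ, Real.cos (θ + 2 * Real.pi * q * ((l : ℝ) / M)) =
      (Complex.exp (θ * Complex.I) * ζ ^ l).re := by
    intro l
    rw [hζ, ← Complex.exp_nat_mul, ← Complex.exp_add,
      ← Complex.exp_ofReal_mul_I_re]
    congr 2
    push_cast
    ring
  simp_rw [h4]
  rw [← Complex.re_sum, ← Finset.mul_sum, h3]
  simp

theorem fejer_eq_sq (N : ℕ) (t : ℝ) :
    fejer N t = ((∑ a ∈ Finset.range N, Real.cos (2 * Real.pi * a * t)) ^ 2 +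
      (∑ a ∈ Finset.range N, Real.sin (2 * Real.pi * a * t)) ^ 2) / (N : ℝ) ^ 2 := by
  rw [fejer, sq (∑ a ∈ Finset.range N, _), sq (∑ a ∈ Finset.range N, _), Finset.sum_mul_sum,
    Finset.sum_mul_sum, ← Finset.sum_add_distrib]
  congr 1
  refine Finset.sum_congr rfl fun a _ => ?_
  rw [← Finset.sum_add_distrib]
  refine Finset.sum_congr rfl fun b _ => ?_
  rw [← Real.cos_sub]
  congr 1
  ring

theorem fejer_nonneg (N : ℕ) (t : ℝ) : 0 ≤ fejer N t := by
  rw [fejer_eq_sq]; positivity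

/-- Sampling at `M` equidistant points kills every nonzero frequency `a - b`, since `|a - b| < N ≤
M`; the `N` diagonal terms remain. -/
theorem sum_fejer_shift {N M : ℕ} (hN : 0 < N) (hNM : N ≤ M) (t : ℝ) :
    ∑ l ∈ Finset.range M, fejer N (t + (l : ℝ) / M) = M / N := by
  have key : ∀ a ∈ Finset.range N, ∀ b ∈ Finset.range N,
      ∑ l ∈ Finset.range M, Real.cos (2 * Real.pi * ((a : ℝ) - b) * (t + (l : ℝ) / M)) =
        if a = b then (M : ℝ) else 0 := by
    intro a ha b hb
    rw [Finset.mem_range] at ha hb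
    split_ifs with h
    · subst h; simp
    · have hq : ((a : ℤ) - b) ≠ 0 := by omega
      have hq2 : |((a : ℤ) - b)| < M := by rw [abs_lt]; omega
      rw [← sum_cos_arith_eq_zero hq hq2 (2 * Real.pi * ((a : ℝ) - b) * t)]
      refine Finset.sum_congr rfl fun l _ => ?_
      congr 1
      push_cast
      ring
  simp_rw [fejer]
  rw [← Finset.sum_div, Finset.sum_comm]
  have : ∑ a ∈ Finset.range N, ∑ l ∈ Finset.range M, ∑ b ∈ Finset.range N,
      Real.cos (2 * Real.pi * ((a : ℝ) - b) * (t + (l : ℝ) / M)) = N * M := by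
    calc _ = ∑ a ∈ Finset.range N, (M : ℝ) := by
          refine Finset.sum_congr rfl fun a ha => ?_
          rw [Finset.sum_comm, Finset.sum_congr rfl (key a ha)]
          simp only [Finset.sum_ite_eq, ha, if_true]
      _ = N * M := by simp
  rw [this]
  have : (N : ℝ) ≠ 0 := by positivity
  field_simp

/-- Up to normalisation this is the Fourier coefficient of the Fejér kernel at frequency `N - k`:
one side of its triangle, read as a ramp in `k`. -/
theorem sum_indicator_eq_max {N : ℕ} {k : ℤ} (hk : |k| ≤ N) :
    ∑ a ∈ Finset.range N, ∑ b ∈ Finset.range N,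
      (if (N : ℤ) - k + a - b = 0 then (1 : ℝ) else 0) = max (k : ℝ) 0 := by
  rw [abs_le] at hk
  have h1 : ∀ a ∈ Finset.range N, ∑ b ∈ Finset.range N,
      (if (N : ℤ) - k + a - b = 0 then (1 : ℝ) else 0) = if a < k.toNat then 1 else 0 := by
    intro a ha
    rw [Finset.mem_range] at ha
    split_ifs with h
    · rw [Finset.sum_eq_single ((N : ℤ) - k + a).toNat]
      · rw [if_pos (by omega)]
      · intro b _ hb; rw [if_neg (by omega)]
      · intro hb; rw [Finset.mem_range] at hb; omega
    · refine Finset.sum_eq_zero fun b hb => ?_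
      rw [Finset.mem_range] at hb
      rw [if_neg (by omega)]
  rw [Finset.sum_congr rfl h1, ← Finset.sum_filter]
  have h2 : (Finset.range N).filter (fun a => a < k.toNat) = Finset.range k.toNat := by
    ext a; simp only [Finset.mem_filter, Finset.mem_range]; omega
  rw [h2]
  simp only [Finset.sum_const, Finset.card_range, nsmul_eq_mul, mul_one]
  have : ((k.toNat : ℤ) : ℝ) = ((max k 0 : ℤ) : ℝ) := by rw [Int.toNat_eq_max]
  rw [Int.cast_natCast] at this
  rw [this]; push_cast; rfl

/-- Multiplying the Fejér kernel by `sin (2πNt)` moves its triangular spectrum to `±N`. On `|m| ≤ N`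
the two triangles leave `max m 0 - max (-m) 0 = m`, the multiplier of the derivative. The
frequencies `m ± N ± (a - b)` are below `3N` in modulus, so `4N` nodes cause no aliasing. -/
theorem riesz_sum_sin {N : ℕ} (hN : 0 < N) {m : ℤ} (hm : |m| ≤ N) (θ : ℝ) :
    ∑ l ∈ Finset.range (4 * N), rieszCoeff N l *
      Real.sin (θ + 2 * Real.pi * m * rieszNode N l) = 2 * Real.pi * m * Real.cos θ := by
  have hN0 : (N : ℝ) ≠ 0 := by positivity
  have hcos : ∀ (q : ℤ) (φ : ℝ), |q| < (4 * N : ℕ) →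
      ∑ l ∈ Finset.range (4 * N), Real.cos (φ + 2 * Real.pi * q * rieszNode N l) =
        4 * N * Real.cos φ * if q = 0 then 1 else 0 := by
    intro q φ hq
    split_ifs with h
    · subst h; simp
    · rw [mul_zero]; exact sum_cos_arith_eq_zero h hq φ
  have hprod : ∀ X Y W : ℝ, Real.sin X * Real.cos Y * Real.sin W =
      (Real.cos (W - X - Y) + Real.cos (W - X + Y) - Real.cos (W + X + Y)
        - Real.cos (W + X - Y)) / 4 := by
    intro X Y W
    simp only [Real.cos_add, Real.cos_sub, Real.sin_add, Real.sin_sub]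
    ring
  have hab : ∀ a ∈ Finset.range N, ∀ b ∈ Finset.range N,
      ∑ l ∈ Finset.range (4 * N), Real.sin (2 * Real.pi * N * rieszNode N l) *
        Real.cos (2 * Real.pi * ((a : ℝ) - b) * rieszNode N l) *
        Real.sin (θ + 2 * Real.pi * m * rieszNode N l) = N * Real.cos θ *
        ((if (N : ℤ) - m + a - b = 0 then (1 : ℝ) else 0) +
          (if (N : ℤ) - m + b - a = 0 then (1 : ℝ) else 0) -
          (if (N : ℤ) - (-m) + a - b = 0 then (1 : ℝ) else 0) -
          (if (N : ℤ) - (-m) + b - a = 0 then (1 : ℝ) else 0)) := by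
    intro a ha b hb
    rw [Finset.mem_range] at ha hb
    rw [abs_le] at hm
    have e1 := hcos (m - N - (a - b)) θ (by rw [abs_lt]; push_cast; omega)
    have e2 := hcos (m - N + (a - b)) θ (by rw [abs_lt]; push_cast; omega)
    have e3 := hcos (m + N + (a - b)) θ (by rw [abs_lt]; push_cast; omega)
    have e4 := hcos (m + N - (a - b)) θ (by rw [abs_lt]; push_cast; omega)
    have c1 : (m - N - ((a : ℤ) - b) = 0) = ((N : ℤ) - m + a - b = 0) := by
      apply propext; omega
    have c2 : (m - N + ((a : ℤ) - b) = 0) = ((N : ℤ) - m + b - a = 0) := by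
      apply propext; omega
    have c3 : (m + N + ((a : ℤ) - b) = 0) = ((N : ℤ) - (-m) + a - b = 0) := by
      apply propext; omega
    have c4 : (m + N - ((a : ℤ) - b) = 0) = ((N : ℤ) - (-m) + b - a = 0) := by
      apply propext; omega
    simp only [c1] at e1
    simp only [c2] at e2
    simp only [c3] at e3
    simp only [c4] at e4
    have : ∀ l ∈ Finset.range (4 * N), Real.sin (2 * Real.pi * N * rieszNode N l) *
        Real.cos (2 * Real.pi * ((a : ℝ) - b) * rieszNode N l) *
        Real.sin (θ + 2 * Real.pi * m * rieszNode N l) =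
        (Real.cos (θ + 2 * Real.pi * (m - N - (a - b) : ℤ) * rieszNode N l) +
        Real.cos (θ + 2 * Real.pi * (m - N + (a - b) : ℤ) * rieszNode N l) -
        Real.cos (θ + 2 * Real.pi * (m + N + (a - b) : ℤ) * rieszNode N l) -
        Real.cos (θ + 2 * Real.pi * (m + N - (a - b) : ℤ) * rieszNode N l)) / 4 := by
      intro l _
      rw [hprod]
      push_cast
      congr 1
      congr 1
      · congr 1
        · congr 1 <;> (congr 1; ring)
        · congr 1; ring
      · congr 1; ring
    rw [Finset.sum_congr rfl this, ← Finset.sum_div, Finset.sum_sub_distrib,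
      Finset.sum_sub_distrib, Finset.sum_add_distrib, e1, e2, e3, e4]
    ring
  have hcoef : ∀ l, rieszCoeff N l * Real.sin (θ + 2 * Real.pi * m * rieszNode N l) =
      Real.pi / N * ∑ a ∈ Finset.range N, ∑ b ∈ Finset.range N,
        Real.sin (2 * Real.pi * N * rieszNode N l) *
        Real.cos (2 * Real.pi * ((a : ℝ) - b) * rieszNode N l) *
        Real.sin (θ + 2 * Real.pi * m * rieszNode N l) := by
    intro l
    simp_rw [← Finset.sum_mul, ← Finset.mul_sum]
    rw [rieszCoeff, fejer]
    field_simp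
  simp_rw [hcoef]
  rw [← Finset.mul_sum, Finset.sum_comm]
  have : ∑ a ∈ Finset.range N, ∑ l ∈ Finset.range (4 * N), ∑ b ∈ Finset.range N,
        Real.sin (2 * Real.pi * N * rieszNode N l) *
        Real.cos (2 * Real.pi * ((a : ℝ) - b) * rieszNode N l) *
        Real.sin (θ + 2 * Real.pi * m * rieszNode N l) =
      N * Real.cos θ * (2 * m) := by
    calc _ = ∑ a ∈ Finset.range N, ∑ b ∈ Finset.range N, N * Real.cos θ *
        ((if (N : ℤ) - m + a - b = 0 then (1 : ℝ) else 0) +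
          (if (N : ℤ) - m + b - a = 0 then (1 : ℝ) else 0) -
          (if (N : ℤ) - (-m) + a - b = 0 then (1 : ℝ) else 0) -
          (if (N : ℤ) - (-m) + b - a = 0 then (1 : ℝ) else 0)) := by
          refine Finset.sum_congr rfl fun a ha => ?_
          rw [Finset.sum_comm]
          exact Finset.sum_congr rfl (hab a ha)
      _ = _ := by
          simp_rw [← Finset.mul_sum, Finset.sum_sub_distrib, Finset.sum_add_distrib]
          have s1 := sum_indicator_eq_max hm
          have s2 := sum_indicator_eq_max (N := N) (k := -m) (by rwa [abs_neg])
          rw [s1, s2]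
          rw [Finset.sum_comm, s1, Finset.sum_comm, s2]
          push_cast
          congr 1
          rcases le_total (0 : ℝ) m with h | h
          · rw [max_eq_left h, max_eq_right (by linarith)]; ring
          · rw [max_eq_right h, max_eq_left (by linarith)]; ring
  rw [this]
  field_simp

/-- The kernel is nonnegative and its `4N` samples sum to `4`. The outcome is twice Bernstein's
sharp constant `2πN`. -/
theorem sum_abs_rieszCoeff_le {N : ℕ} (hN : 0 < N) :
    ∑ l ∈ Finset.range (4 * N), |rieszCoeff N l| ≤ 4 * Real.pi * N := by
  have hN0 : (N : ℝ) ≠ 0 := by positivity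
  calc ∑ l ∈ Finset.range (4 * N), |rieszCoeff N l|
      ≤ ∑ l ∈ Finset.range (4 * N), Real.pi * N * fejer N (0 + (l : ℝ) / (4 * N : ℕ)) := by
        refine Finset.sum_le_sum fun l _ => ?_
        rw [zero_add, rieszCoeff, abs_mul, abs_mul, abs_of_nonneg (fejer_nonneg _ _),
          abs_of_nonneg (by positivity : 0 ≤ Real.pi * (N : ℝ))]
        refine mul_le_mul_of_nonneg_right ?_ (fejer_nonneg _ _)
        exact mul_le_of_le_one_right (by positivity) (Real.abs_sin_le_one _)
    _ = 4 * Real.pi * N := by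
        rw [← Finset.mul_sum, sum_fejer_shift hN (by omega)]
        push_cast
        field_simp

/-! ### Bernstein inequalities from Riesz's formula. -/

/-- Smooth functions on `ℝ` whose derivative is given by the interpolation formula of M. Riesz,
such as the trigonometric polynomials of period `1` and degree at most `N`. -/
structure RieszFormula (N : ℕ) (f : ℝ → ℝ) : Prop where
  contDiff : ContDiff ℝ ((⊤ : ℕ∞) : WithTop ℕ∞) f
  hasDerivAt : ∀ x, HasDerivAt f
    (∑ l ∈ Finset.range (4 * N), rieszCoeff N l * f (x + rieszNode N l)) x

namespace RieszFormula

theorem sin_phase {N : ℕ} (hN : 0 < N) {m : ℤ} (hm : |m| ≤ N) (θ : ℝ) :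
    RieszFormula N (fun t => Real.sin (θ + 2 * Real.pi * m * t)) where
  contDiff := by fun_prop
  hasDerivAt x := by
    have h := riesz_sum_sin hN hm (θ + 2 * Real.pi * m * x)
    have h2 : ∀ l, θ + 2 * Real.pi * m * (x + rieszNode N l) =
        θ + 2 * Real.pi * m * x + 2 * Real.pi * m * rieszNode N l := fun l => by ring
    simp_rw [h2, h]
    have h3 : HasDerivAt (fun t : ℝ => θ + 2 * Real.pi * m * t) (2 * Real.pi * m) x := by
      simpa using ((hasDerivAt_id x).const_mul (2 * Real.pi * m)).const_add θ
    convert h3.sin using 1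
    ring

theorem const_mul {N : ℕ} {f : ℝ → ℝ} (hf : RieszFormula N f) (c : ℝ) :
    RieszFormula N (fun t => c * f t) where
  contDiff := contDiff_const.mul hf.contDiff
  hasDerivAt x := by
    refine ((hf.hasDerivAt x).const_mul c).congr_deriv ?_
    rw [Finset.mul_sum]
    exact Finset.sum_congr rfl fun l _ => by ring

theorem sum {N : ℕ} {ι : Type*} {s : Finset ι} {f : ι → ℝ → ℝ}
    (hf : ∀ i ∈ s, RieszFormula N (f i)) : RieszFormula N (fun t => ∑ i ∈ s, f i t) where
  contDiff := ContDiff.sum fun i hi => (hf i hi).contDiff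
  hasDerivAt x := by
    refine (HasDerivAt.fun_sum fun i hi => (hf i hi).hasDerivAt x).congr_deriv ?_
    rw [Finset.sum_comm]
    exact Finset.sum_congr rfl fun l _ => by rw [Finset.mul_sum]

theorem fejer_sub {N : ℕ} (hN : 0 < N) (c : ℝ) : RieszFormula N (fun t => fejer N (t - c)) := by
  have h : (fun t => fejer N (t - c)) = fun t => ((N : ℝ) ^ 2)⁻¹ *
      ∑ a ∈ Finset.range N, ∑ b ∈ Finset.range N,
        Real.sin ((Real.pi / 2 - 2 * Real.pi * ((a : ℝ) - b) * c) +
          2 * Real.pi * ((a - b : ℤ) : ℝ) * t) := by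
    funext t
    rw [fejer, div_eq_inv_mul]
    congr 1
    refine Finset.sum_congr rfl fun a _ => Finset.sum_congr rfl fun b _ => ?_
    rw [← Real.sin_add_pi_div_two]
    congr 1
    push_cast
    ring
  rw [h]
  refine (sum fun a ha => sum fun b hb => sin_phase hN ?_ _).const_mul _
  rw [Finset.mem_range] at ha hb
  rw [abs_le]
  omega

/-- The kernel has degree `N - 1`, which leaves room for exactly one factor of degree `1`. -/
theorem sin_mul_fejer_sub {N : ℕ} (hN : 0 < N) (c : ℝ) :
    RieszFormula N (fun t => Real.sin (2 * Real.pi * t) * fejer N (t - c)) := by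
  have h : (fun t => Real.sin (2 * Real.pi * t) * fejer N (t - c)) = fun t => (2 * (N : ℝ) ^ 2)⁻¹ *
      ∑ j : Fin 2, ∑ a ∈ Finset.range N, ∑ b ∈ Finset.range N,
        Real.sin ((if j = 0 then -(2 * Real.pi * ((a : ℝ) - b) * c)
          else 2 * Real.pi * ((a : ℝ) - b) * c) +
          2 * Real.pi * ((if j = 0 then 1 + (a - b : ℤ) else 1 - (a - b : ℤ) : ℤ) : ℝ) * t) := by
    funext t
    rw [fejer, Fin.sum_univ_two, ← Finset.sum_add_distrib]
    simp_rw [← Finset.sum_add_distrib]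
    rw [mul_div_assoc', Finset.mul_sum, div_eq_inv_mul, mul_inv, mul_comm (2⁻¹ : ℝ), mul_assoc ((N : ℝ) ^ 2)⁻¹]
    refine congrArg _ ?_
    rw [Finset.mul_sum]
    refine Finset.sum_congr rfl fun a _ => ?_
    rw [Finset.mul_sum, Finset.mul_sum]
    refine Finset.sum_congr rfl fun b _ => ?_
    have : ∀ x y : ℝ, Real.sin x * Real.cos y = 2⁻¹ * (Real.sin (x + y) + Real.sin (x - y)) := by
      intro x y; rw [Real.sin_add, Real.sin_sub]; ring
    rw [this]
    simp only [if_true, Fin.isValue, one_ne_zero, if_false]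
    push_cast
    congr 2
    · congr 1; ring
    · congr 1; ring
  rw [h]
  refine (sum fun j _ => sum fun a ha => sum fun b hb => sin_phase hN ?_ _).const_mul _
  rw [Finset.mem_range] at ha hb
  rw [abs_le]
  split_ifs <;> omega

end RieszFormula

theorem euclidean_eq_sum_single {d : ℕ} (v : EuclideanSpace ℝ (Fin d)) :
    v = ∑ i, v i • EuclideanSpace.single i (1 : ℝ) := by
  ext j
  simp [Finset.sum_apply, Pi.single_apply]

/-- Smooth functions on `ℝ^d` whose partial derivatives are given by the interpolation formula of
M. Riesz in the corresponding variable. -/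
structure PartialRieszFormula {d : ℕ} (N : ℕ) (u : EuclideanSpace ℝ (Fin d) → ℝ) : Prop where
  contDiff : ContDiff ℝ ((⊤ : ℕ∞) : WithTop ℕ∞) u
  fderiv_single : ∀ i x, fderiv ℝ u x (EuclideanSpace.single i 1) =
    ∑ l ∈ Finset.range (4 * N), rieszCoeff N l *
      u (x + rieszNode N l • EuclideanSpace.single i (1 : ℝ))

namespace PartialRieszFormula

variable {d N : ℕ} {u : EuclideanSpace ℝ (Fin d) → ℝ}

theorem differentiable (hu : PartialRieszFormula N u) : Differentiable ℝ u :=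
  hu.contDiff.differentiable (by simp)

theorem const_mul (hu : PartialRieszFormula N u) (c : ℝ) :
    PartialRieszFormula N (fun x => c * u x) where
  contDiff := contDiff_const.mul hu.contDiff
  fderiv_single i x := by
    rw [fderiv_const_mul (hu.differentiable x)]
    change c * fderiv ℝ u x _ = _
    rw [hu.fderiv_single, Finset.mul_sum]
    exact Finset.sum_congr rfl fun l _ => by ring

theorem sum {ι : Type*} {s : Finset ι} {f : ι → EuclideanSpace ℝ (Fin d) → ℝ}
    (hf : ∀ i ∈ s, PartialRieszFormula N (f i)) :
    PartialRieszFormula N (fun x => ∑ i ∈ s, f i x) where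
  contDiff := ContDiff.sum fun i hi => (hf i hi).contDiff
  fderiv_single i x := by
    rw [fderiv_fun_sum fun j hj => (hf j hj).differentiable x, sum_apply,
      Finset.sum_congr rfl fun j hj => (hf j hj).fderiv_single i x, Finset.sum_comm]
    exact Finset.sum_congr rfl fun l _ => by rw [Finset.mul_sum]

theorem translate (hu : PartialRieszFormula N u) (v : EuclideanSpace ℝ (Fin d)) :
    PartialRieszFormula N (fun x => u (x + v)) where
  contDiff := hu.contDiff.comp (contDiff_id.add contDiff_const)
  fderiv_single i x := by
    rw [fderiv_comp_add_right, hu.fderiv_single]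
    exact Finset.sum_congr rfl fun l _ => by rw [add_right_comm]

/-- The partial derivative is a combination of translates of `u`, and the formula is stable under
both operations. This is what allows Bernstein's inequality to be iterated. -/
theorem partial_single (hu : PartialRieszFormula N u) (i : Fin d) :
    PartialRieszFormula N (fun x => fderiv ℝ u x (EuclideanSpace.single i 1)) := by
  simp_rw [hu.fderiv_single i]
  exact sum fun l _ => (hu.translate _).const_mul _

theorem abs_fderiv_single_le (hN : 0 < N) (hu : PartialRieszFormula N u) {B : ℝ}
    (hB : ∀ x, |u x| ≤ B) (i : Fin d) (x : EuclideanSpace ℝ (Fin d)) :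
    |fderiv ℝ u x (EuclideanSpace.single i 1)| ≤ 4 * Real.pi * N * B := by
  rw [hu.fderiv_single]
  calc _ ≤ ∑ l ∈ Finset.range (4 * N), |rieszCoeff N l| * B := by
        refine (Finset.abs_sum_le_sum_abs _ _).trans (Finset.sum_le_sum fun l _ => ?_)
        rw [abs_mul]
        exact mul_le_mul_of_nonneg_left (hB _) (abs_nonneg _)
    _ ≤ _ := by
        rw [← Finset.sum_mul]
        exact mul_le_mul_of_nonneg_right (sum_abs_rieszCoeff_le hN)
          ((abs_nonneg _).trans (hB 0))

theorem abs_fderiv_le (hN : 0 < N) (hu : PartialRieszFormula N u) {B : ℝ}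
    (hB : ∀ x, |u x| ≤ B) (x v : EuclideanSpace ℝ (Fin d)) :
    |fderiv ℝ u x v| ≤ d * (4 * Real.pi * N * B) * ‖v‖ := by
  conv_lhs => rw [euclidean_eq_sum_single v]
  rw [map_sum]
  calc _ ≤ ∑ _i : Fin d, ‖v‖ * (4 * Real.pi * N * B) := by
        refine (Finset.abs_sum_le_sum_abs _ _).trans (Finset.sum_le_sum fun i _ => ?_)
        rw [map_smul, smul_eq_mul, abs_mul]
        exact mul_le_mul (PiLp.norm_apply_le v i) (hu.abs_fderiv_single_le hN hB i x)
          (abs_nonneg _) (norm_nonneg _)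
    _ = _ := by simp; ring

theorem abs_sub_le (hN : 0 < N) (hu : PartialRieszFormula N u) {B : ℝ}
    (hB : ∀ x, |u x| ≤ B) (x y : EuclideanSpace ℝ (Fin d)) :
    |u x - u y| ≤ d * (4 * Real.pi * N * B) * ‖x - y‖ := by
  have hB0 : 0 ≤ B := (abs_nonneg _).trans (hB 0)
  have := Convex.norm_image_sub_le_of_norm_fderiv_le (𝕜 := ℝ) (f := u) (s := univ)
    (C := d * (4 * Real.pi * N * B)) (fun z _ => hu.differentiable z)
    (fun z _ => ContinuousLinearMap.opNorm_le_bound _ (by positivity)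
      fun v => hu.abs_fderiv_le hN hB z v) convex_univ (mem_univ y) (mem_univ x)
  exact this

/-- Motion along a single axis avoids the factor `d` of `abs_sub_le`; the shears only need this
direction. -/
theorem abs_add_smul_single_sub_le (hN : 0 < N) (hu : PartialRieszFormula N u) {B : ℝ}
    (hB : ∀ x, |u x| ≤ B) (x : EuclideanSpace ℝ (Fin d)) (i : Fin d) (s : ℝ) :
    |u (x + s • EuclideanSpace.single i (1 : ℝ)) - u x| ≤ 4 * Real.pi * N * B * |s| := by
  have hd : ∀ r : ℝ, HasDerivAt (fun r : ℝ => u (x + r • EuclideanSpace.single i (1 : ℝ)))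
      (fderiv ℝ u (x + r • EuclideanSpace.single i (1 : ℝ)) (EuclideanSpace.single i 1)) r := by
    intro r
    have h1 : HasDerivAt (fun r : ℝ => x + r • EuclideanSpace.single i (1 : ℝ))
        (EuclideanSpace.single i (1 : ℝ)) r := by
      simpa using ((hasDerivAt_id r).smul_const (EuclideanSpace.single i (1 : ℝ))).const_add x
    exact (hu.differentiable _).hasFDerivAt.comp_hasDerivAt r h1
  have := Convex.norm_image_sub_le_of_norm_hasDerivWithin_le (s := univ)
    (C := 4 * Real.pi * N * B) (fun r _ => (hd r).hasDerivWithinAt)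
    (fun r _ => hu.abs_fderiv_single_le hN hB i _) convex_univ (mem_univ 0) (mem_univ s)
  simpa using this

/-- Iterated Bernstein inequality. The absence of any further factor depending on `k` is what keeps
the final constant free of `β`. -/
theorem iteratedFDeriv_single (hN : 0 < N) {k : ℕ} :
    ∀ {u : EuclideanSpace ℝ (Fin d) → ℝ} (_ : PartialRieszFormula N u) {B : ℝ}
      (_ : ∀ x, |u x| ≤ B) (ι : Fin k → Fin d),
      PartialRieszFormula N
        (fun x => iteratedFDeriv ℝ k u x (fun j => EuclideanSpace.single (ι j) (1 : ℝ))) ∧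
      ∀ x, |iteratedFDeriv ℝ k u x (fun j => EuclideanSpace.single (ι j) (1 : ℝ))| ≤
        (4 * Real.pi * N) ^ k * B := by
  induction k with
  | zero => intro u hu B hB ι; simpa using ⟨hu, hB⟩
  | succ k ih =>
    intro u hu B hB ι
    have h := ih (hu.partial_single (ι (Fin.last k)))
      (hu.abs_fderiv_single_le hN hB _) (fun j => ι j.castSucc)
    have heq : ∀ x, iteratedFDeriv ℝ (k + 1) u x
        (fun j => EuclideanSpace.single (ι j) (1 : ℝ)) =
        iteratedFDeriv ℝ k (fun x => fderiv ℝ u x (EuclideanSpace.single (ι (Fin.last k)) 1)) x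
          (fun j => EuclideanSpace.single (ι j.castSucc) (1 : ℝ)) := by
      intro x
      rw [iteratedFDeriv_succ_apply_right]
      have hc : ContDiff ℝ ((⊤ : ℕ∞) : WithTop ℕ∞) (fun y => fderiv ℝ u y) :=
        hu.contDiff.fderiv_right (by simp)
      have := ((ContinuousLinearMap.apply ℝ ℝ
        (EuclideanSpace.single (ι (Fin.last k)) (1 : ℝ)))).iteratedFDeriv_comp_left
          (f := fun y => fderiv ℝ u y) (x := x) (i := k) hc.contDiffAt (by exact_mod_cast le_top)
      have e2 : (fun x => fderiv ℝ u x (EuclideanSpace.single (ι (Fin.last k)) 1)) =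
        (ContinuousLinearMap.apply ℝ ℝ
        (EuclideanSpace.single (ι (Fin.last k)) (1 : ℝ))) ∘ (fun y => fderiv ℝ u y) := rfl
      rw [e2, this]
      rfl
    simp_rw [heq]
    refine ⟨h.1, fun x => (h.2 x).trans_eq (by ring)⟩

theorem _root_.prod_add_smul_single (φ : Fin d → ℝ → ℝ) (x : EuclideanSpace ℝ (Fin d)) (i : Fin d)
    (s : ℝ) : ∏ j, φ j ((x + s • EuclideanSpace.single i (1 : ℝ)) j) =
      φ i (x i + s) * ∏ j ∈ Finset.univ.erase i, φ j (x j) := by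
  rw [← Finset.mul_prod_erase _ _ (Finset.mem_univ i)]
  congr 1
  · simp
  · refine Finset.prod_congr rfl fun j hj => ?_
    have : j ≠ i := Finset.ne_of_mem_erase hj
    simp [this]

theorem _root_.contDiff_prod_coord {φ : Fin d → ℝ → ℝ} (hφ : ∀ i, RieszFormula N (φ i)) :
    ContDiff ℝ ((⊤ : ℕ∞) : WithTop ℕ∞)
      (fun x : EuclideanSpace ℝ (Fin d) => ∏ i, φ i (x i)) :=
  contDiff_prod fun i _ => (hφ i).contDiff.comp (EuclideanSpace.proj (𝕜 := ℝ) i).contDiff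

theorem _root_.fderiv_prod_coord_single {φ : Fin d → ℝ → ℝ} (hφ : ∀ i, RieszFormula N (φ i))
    (i : Fin d) (x : EuclideanSpace ℝ (Fin d)) {φ' : ℝ} (h' : HasDerivAt (φ i) φ' (x i)) :
    fderiv ℝ (fun x : EuclideanSpace ℝ (Fin d) => ∏ i, φ i (x i)) x (EuclideanSpace.single i 1) =
      φ' * ∏ j ∈ Finset.univ.erase i, φ j (x j) := by
  have h1 := (((contDiff_prod_coord hφ).differentiable (by simp)) x).hasFDerivAt.hasLineDerivAt
    (EuclideanSpace.single i (1 : ℝ))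
  have h2 : HasLineDerivAt ℝ (fun x : EuclideanSpace ℝ (Fin d) => ∏ i, φ i (x i))
      (φ' * ∏ j ∈ Finset.univ.erase i, φ j (x j)) x (EuclideanSpace.single i 1) := by
    rw [HasLineDerivAt]
    simp_rw [prod_add_smul_single φ x i]
    have h4 : HasDerivAt (fun s : ℝ => φ i (x i + s)) φ' 0 := by
      apply HasDerivAt.comp_const_add
      simpa using h'
    exact h4.mul_const _
  exact h1.unique h2

theorem prod {φ : Fin d → ℝ → ℝ} (hφ : ∀ i, RieszFormula N (φ i)) :
    PartialRieszFormula N (fun x : EuclideanSpace ℝ (Fin d) => ∏ i, φ i (x i)) where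
  contDiff := contDiff_prod_coord hφ
  fderiv_single i x := by
    rw [fderiv_prod_coord_single hφ i x ((hφ i).hasDerivAt (x i)), Finset.sum_mul]
    simp_rw [prod_add_smul_single φ x i]
    exact Finset.sum_congr rfl fun l _ => by ring

end PartialRieszFormula

/-! ### Mass, size and slope of the Fejér kernel. -/

theorem fejer_periodic (N : ℕ) : Function.Periodic (fejer N) 1 := by
  intro t
  rw [fejer, fejer]
  congr 1
  refine Finset.sum_congr rfl fun a _ => Finset.sum_congr rfl fun b _ => ?_
  rw [← Real.cos_add_int_mul_two_pi (2 * Real.pi * ((a : ℝ) - b) * t) (a - b)]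
  congr 1
  push_cast
  ring

theorem contDiff_fejer (N : ℕ) : ContDiff ℝ ((⊤ : ℕ∞) : WithTop ℕ∞) (fejer N) := by
  unfold fejer
  fun_prop

theorem continuous_fejer (N : ℕ) : Continuous (fejer N) := (contDiff_fejer N).continuous

theorem sum_fejer_sub_eq_one {N : ℕ} (hN : 0 < N) (t : ℝ) :
    ∑ l ∈ Finset.range N, fejer N (t - (l : ℝ) / N) = 1 := by
  have h := sum_fejer_shift hN le_rfl (-t)
  rw [div_self (by positivity)] at h
  rw [← h]
  refine Finset.sum_congr rfl fun l _ => ?_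
  rw [fejer_eq_sq, fejer_eq_sq]
  have e : ∀ a : ℕ, 2 * Real.pi * a * (t - (l : ℝ) / N) =
    -(2 * Real.pi * a * (-t + (l : ℝ) / N)) := fun a => by ring
  simp only [e, Real.cos_neg, Real.sin_neg, Finset.sum_neg_distrib, neg_sq]

/-- The `N` translates by multiples of `1 / N` add up to `1` and have equal integrals by
periodicity. -/
theorem integral_fejer_sub {N : ℕ} (hN : 0 < N) (b : ℝ) :
    ∫ t in Icc (0 : ℝ) 1, fejer N (t - b) = 1 / N := by
  have hN0 : (N : ℝ) ≠ 0 := by positivity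
  rw [integral_Icc_eq_integral_Ioc, ← intervalIntegral.integral_of_le zero_le_one]
  have hint : ∀ (f : ℝ → ℝ), Continuous f → IntervalIntegrable f volume 0 1 :=
    fun f hf => hf.intervalIntegrable _ _
  have hshift : ∀ l : ℕ, ∫ t in (0 : ℝ)..1, fejer N (t - (b + (l : ℝ) / N)) =
      ∫ t in (0 : ℝ)..1, fejer N (t - b) := by
    intro l
    rw [intervalIntegral.integral_comp_sub_right, intervalIntegral.integral_comp_sub_right]
    have h1 := (fejer_periodic N).intervalIntegral_add_eq (0 - (b + (l : ℝ) / N)) (0 - b)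
    convert! h1 using 2 <;> ring
  have h : ∑ l ∈ Finset.range N, ∫ t in (0 : ℝ)..1, fejer N (t - (b + (l : ℝ) / N)) = 1 := by
    rw [← intervalIntegral.integral_finsetSum
      (f := fun (l : ℕ) t => fejer N (t - (b + (l : ℝ) / N)))
      (fun l _ => hint _ ((continuous_fejer N).comp (by fun_prop)))]
    have : ∀ t : ℝ, ∑ l ∈ Finset.range N, fejer N (t - (b + (l : ℝ) / N)) = 1 := by
      intro t
      rw [← sum_fejer_sub_eq_one hN (t - b)]
      exact Finset.sum_congr rfl fun l _ => by congr 1; ring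
    simp [this]
  simp_rw [hshift] at h
  rw [Finset.sum_const, Finset.card_range, nsmul_eq_mul] at h
  rw [eq_div_iff hN0, mul_comm]
  exact h

/-- In this range every cosine of the double sum has an angle of modulus at most `π / 3`. -/
theorem fejer_ge_half {N : ℕ} (hN : 0 < N) {t : ℝ} (ht : |t| ≤ 1 / (6 * N)) :
    1 / 2 ≤ fejer N t := by
  have hN0 : (0 : ℝ) < N := by positivity
  rw [fejer, le_div_iff₀ (by positivity)]
  calc 1 / 2 * (N : ℝ) ^ 2 = ∑ a ∈ Finset.range N, ∑ b ∈ Finset.range N, (1 / 2 : ℝ) := by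
        simp; ring
    _ ≤ _ := by
        refine Finset.sum_le_sum fun a ha => Finset.sum_le_sum fun b hb => ?_
        rw [Finset.mem_range] at ha hb
        rw [← Real.cos_pi_div_three, ← Real.cos_abs (2 * Real.pi * _ * t)]
        have ha' : (a : ℝ) + 1 ≤ N := by exact_mod_cast ha
        have hb' : (b : ℝ) + 1 ≤ N := by exact_mod_cast hb
        have ha0 : (0 : ℝ) ≤ a := by positivity
        have hb0 : (0 : ℝ) ≤ b := by positivity
        have hab : |(a : ℝ) - b| ≤ N := by rw [abs_le]; constructor <;> linarith
        have : |2 * Real.pi * ((a : ℝ) - b) * t| ≤ Real.pi / 3 := by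
          rw [abs_mul, abs_mul, abs_of_pos (by positivity : (0 : ℝ) < 2 * Real.pi)]
          calc _ ≤ 2 * Real.pi * N * (1 / (6 * N)) := by gcongr
            _ = Real.pi / 3 := by field_simp; norm_num
        refine Real.cos_le_cos_of_nonneg_of_le_pi (abs_nonneg _) ?_ this
        linarith [Real.pi_pos]

theorem sum_range_sq_sub (N : ℕ) :
    ∑ a ∈ Finset.range N, ∑ b ∈ Finset.range N, ((a : ℝ) - b) ^ 2 =
      (N : ℝ) ^ 2 * ((N : ℝ) ^ 2 - 1) / 6 := by
  have h1 : ∀ n : ℕ, ∑ a ∈ Finset.range n, (a : ℝ) = n * (n - 1) / 2 := by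
    intro n
    induction n with
    | zero => simp
    | succ n ih => rw [Finset.sum_range_succ, ih]; push_cast; ring
  have h2 : ∀ n : ℕ, ∑ a ∈ Finset.range n, (a : ℝ) ^ 2 = n * (n - 1) * (2 * n - 1) / 6 := by
    intro n
    induction n with
    | zero => simp
    | succ n ih => rw [Finset.sum_range_succ, ih]; push_cast; ring
  have h3 : ∀ a b : ℝ, (a - b) ^ 2 = a ^ 2 - 2 * a * b + b ^ 2 := fun a b => by ring
  simp_rw [h3, Finset.sum_add_distrib, Finset.sum_sub_distrib, ← Finset.mul_sum, ← Finset.sum_mul]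
  simp only [Finset.sum_const, Finset.card_range, nsmul_eq_mul]
  simp_rw [← Finset.mul_sum]
  rw [h1, h2]
  ring

theorem hasDerivAt_fejer (N : ℕ) (t : ℝ) :
    HasDerivAt (fejer N) (-(∑ a ∈ Finset.range N, ∑ b ∈ Finset.range N,
      2 * Real.pi * ((a : ℝ) - b) * Real.sin (2 * Real.pi * ((a : ℝ) - b) * t)) / (N : ℝ) ^ 2)
      t := by
  unfold fejer
  refine HasDerivAt.div_const ?_ _
  rw [← Finset.sum_neg_distrib]
  refine HasDerivAt.fun_sum fun a _ => ?_
  rw [← Finset.sum_neg_distrib]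
  refine HasDerivAt.fun_sum fun b _ => ?_
  have h3 : HasDerivAt (fun t : ℝ => 2 * Real.pi * ((a : ℝ) - b) * t)
      (2 * Real.pi * ((a : ℝ) - b)) t := by
    simpa using (hasDerivAt_id t).const_mul (2 * Real.pi * ((a : ℝ) - b))
  exact h3.cos.congr_deriv (by ring)

/-- All angles are at most `π / 2` in modulus, so Jordan's inequality `sin y ≥ 2y / π` bounds each
term below by a multiple of `(a - b) ^ 2`. -/
theorem deriv_fejer_le {N : ℕ} (hN : 2 ≤ N) {t : ℝ} (ht : 1 / (8 * N) ≤ t)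
    (ht' : t ≤ 1 / (4 * N)) : deriv (fejer N) t ≤ -(N / 4) := by
  have hN0 : (0 : ℝ) < N := by positivity
  have hN2 : (2 : ℝ) ≤ N := by exact_mod_cast hN
  have ht0 : 0 ≤ t := le_trans (by positivity) ht
  rw [(hasDerivAt_fejer N t).deriv, div_le_iff₀ (by positivity)]
  have hterm : ∀ a ∈ Finset.range N, ∀ b ∈ Finset.range N,
      8 * Real.pi * t * ((a : ℝ) - b) ^ 2 ≤
        2 * Real.pi * ((a : ℝ) - b) * Real.sin (2 * Real.pi * ((a : ℝ) - b) * t) := by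
    intro a ha b hb
    rw [Finset.mem_range] at ha hb
    have ha' : (a : ℝ) + 1 ≤ N := by exact_mod_cast ha
    have hb' : (b : ℝ) + 1 ≤ N := by exact_mod_cast hb
    have ha0 : (0 : ℝ) ≤ a := by positivity
    have hb0 : (0 : ℝ) ≤ b := by positivity
    have key : ∀ k : ℝ, 0 ≤ k → k ≤ N →
        8 * Real.pi * t * k ^ 2 ≤ 2 * Real.pi * k * Real.sin (2 * Real.pi * k * t) := by
      intro k hk hkN
      have h1 : 2 * Real.pi * k * t ≤ Real.pi / 2 := by
        calc _ ≤ 2 * Real.pi * N * (1 / (4 * N)) := by gcongr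
          _ = Real.pi / 2 := by field_simp; norm_num
      have h2 := Real.mul_le_sin (by positivity : 0 ≤ 2 * Real.pi * k * t) h1
      have h3 : 2 / Real.pi * (2 * Real.pi * k * t) = 4 * k * t := by
        field_simp; ring
      rw [h3] at h2
      calc 8 * Real.pi * t * k ^ 2 = 2 * Real.pi * k * (4 * k * t) := by ring
        _ ≤ _ := by gcongr
    rcases le_total (0 : ℝ) ((a : ℝ) - b) with h | h
    · exact key _ h (by linarith)
    · have := key (-((a : ℝ) - b)) (by linarith) (by linarith)
      have e : 2 * Real.pi * -((a : ℝ) - b) * t = -(2 * Real.pi * ((a : ℝ) - b) * t) := by ring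
      rw [e, Real.sin_neg] at this
      linarith
  have hsum := Finset.sum_le_sum fun a ha => Finset.sum_le_sum (hterm a ha)
  simp_rw [← Finset.mul_sum] at hsum
  rw [sum_range_sq_sub] at hsum
  have h5 : (N : ℝ) ^ 2 * (N / 4) ≤
      8 * Real.pi * t * ((N : ℝ) ^ 2 * ((N : ℝ) ^ 2 - 1) / 6) := by
    have h6 : (N : ℝ) ^ 2 / 2 ≤ (N : ℝ) ^ 2 - 1 := by nlinarith
    calc (N : ℝ) ^ 2 * (N / 4) ≤ 8 * 3 * (1 / (8 * N)) * ((N : ℝ) ^ 2 * ((N : ℝ) ^ 2 / 2) / 6) := by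
          rw [le_iff_eq_or_lt]; left; field_simp; norm_num
      _ ≤ _ := by
          gcongr
          exact Real.pi_gt_three.le
  linarith

/-! ### Localised waves: sup, L¹ and slope estimates. -/

/-- A trigonometric polynomial on `ℝ^d` that is concentrated around `c` and vanishes where the
coordinate `x i₀` is `0` or `1`. -/
noncomputable def trigWave {d : ℕ} (N : ℕ) (i₀ : Fin d) (c : Fin d → ℝ)
    (x : EuclideanSpace ℝ (Fin d)) : ℝ :=
  ∏ i, (if i = i₀ then Real.sin (2 * Real.pi * x i) else 1) * fejer N (x i - c i)

theorem rieszFormula_trigWave_factor {d N : ℕ} (hN : 0 < N) (i₀ : Fin d) (c : Fin d → ℝ)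
    (i : Fin d) :
    RieszFormula N
      (fun t => (if i = i₀ then Real.sin (2 * Real.pi * t) else 1) * fejer N (t - c i)) := by
  split_ifs
  · exact RieszFormula.sin_mul_fejer_sub hN _
  · simpa using RieszFormula.fejer_sub hN (c i)

theorem partialRieszFormula_trigWave {d N : ℕ} (hN : 0 < N) (i₀ : Fin d) (c : Fin d → ℝ) :
    PartialRieszFormula N (trigWave N i₀ c) :=
  PartialRieszFormula.prod (rieszFormula_trigWave_factor hN i₀ c)

theorem abs_trigWave_le {d : ℕ} (N : ℕ) (i₀ : Fin d) (c : Fin d → ℝ)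
    (x : EuclideanSpace ℝ (Fin d)) : |trigWave N i₀ c x| ≤ ∏ i, fejer N (x i - c i) := by
  rw [trigWave, Finset.abs_prod]
  refine Finset.prod_le_prod (fun _ _ => abs_nonneg _) fun i _ => ?_
  rw [abs_mul, abs_of_nonneg (fejer_nonneg _ _)]
  refine mul_le_of_le_one_left (fejer_nonneg _ _) ?_
  split_ifs
  · exact Real.abs_sin_le_one _
  · simp

theorem trigWave_eq_zero {d : ℕ} (N : ℕ) (i₀ : Fin d) (c : Fin d → ℝ)
    {x : EuclideanSpace ℝ (Fin d)} (hx : x i₀ = 0 ∨ x i₀ = 1) : trigWave N i₀ c x = 0 := by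
  rw [trigWave]
  refine Finset.prod_eq_zero (Finset.mem_univ i₀) ?_
  rcases hx with h | h <;> simp [h]

theorem fejer_le_one {N : ℕ} (hN : 0 < N) (t : ℝ) : fejer N t ≤ 1 := by
  rw [← sum_fejer_sub_eq_one hN t]
  have := Finset.single_le_sum (f := fun l : ℕ => fejer N (t - (l : ℝ) / N))
    (fun l _ => fejer_nonneg N _) (Finset.mem_range.2 hN)
  simpa using this

theorem abs_trigWave_le_one {d N : ℕ} (hN : 0 < N) (i₀ : Fin d) (c : Fin d → ℝ)
    (x : EuclideanSpace ℝ (Fin d)) : |trigWave N i₀ c x| ≤ 1 :=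
  (abs_trigWave_le N i₀ c x).trans
    (Finset.prod_le_one (fun _ _ => fejer_nonneg _ _) fun _ _ => fejer_le_one hN _)

/-- The points of a grid of mesh `1 / (8 * M)` in the cube `[1/8, 1/4]^d`. -/
noncomputable def gridCenter {d : ℕ} (M : ℕ) (j : Fin d → Fin M) (i : Fin d) : ℝ :=
  ((M : ℝ) + (j i : ℕ)) / (8 * M : ℕ)

theorem sum_fejer_gridCenter_le_one {M : ℕ} (hM : 0 < M) (t : ℝ) :
    ∑ m : Fin M, fejer (8 * M) (t - ((M : ℝ) + (m : ℕ)) / (8 * M : ℕ)) ≤ 1 := by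
  rw [← sum_fejer_sub_eq_one (N := 8 * M) (by omega) t]
  rw [Fin.sum_univ_eq_sum_range
    (fun m => fejer (8 * M) (t - ((M : ℝ) + (m : ℝ)) / (8 * M : ℕ))) M]
  have h : ∑ m ∈ Finset.range M, fejer (8 * M) (t - ((M : ℝ) + (m : ℝ)) / (8 * M : ℕ)) =
      ∑ l ∈ Finset.Ico M (M + M), fejer (8 * M) (t - (l : ℝ) / (8 * M : ℕ)) := by
    rw [Finset.sum_Ico_eq_sum_range]
    simp
  rw [h]
  refine Finset.sum_le_sum_of_subset_of_nonneg ?_ fun _ _ _ => fejer_nonneg _ _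
  intro l hl
  rw [Finset.mem_Ico] at hl
  rw [Finset.mem_range]
  omega

/-- The sum of the Fejér products over the grid factorises into `d` sums, each part of a
one-dimensional partition of unity; hence a bound independent of the number of waves. -/
theorem abs_sum_trigWave_le_one {d M : ℕ} (hM : 0 < M) (i₀ : Fin d)
    (a : (Fin d → Fin M) → ℝ) (ha : ∀ j, |a j| ≤ 1) (x : EuclideanSpace ℝ (Fin d)) :
    |∑ j, a j * trigWave (8 * M) i₀ (gridCenter M j) x| ≤ 1 := by
  calc _ ≤ ∑ j : Fin d → Fin M, ∏ i, fejer (8 * M) (x i - gridCenter M j i) := by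
        refine (Finset.abs_sum_le_sum_abs _ _).trans (Finset.sum_le_sum fun j _ => ?_)
        rw [abs_mul]
        exact (mul_le_of_le_one_left (abs_nonneg _) (ha j)).trans (abs_trigWave_le _ _ _ _)
    _ = ∏ i, ∑ m : Fin M, fejer (8 * M) (x i - ((M : ℝ) + (m : ℕ)) / (8 * M : ℕ)) := by
        rw [Finset.prod_univ_sum, Fintype.piFinset_univ]
        rfl
    _ ≤ 1 := Finset.prod_le_one (fun i _ => Finset.sum_nonneg fun _ _ => fejer_nonneg _ _)
        fun i _ => sum_fejer_gridCenter_le_one hM _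

theorem isClosed_unitCube (d : ℕ) : IsClosed (unitCube d) := by
  have : unitCube d = ⋂ i, {x | x i ∈ Set.Icc (0 : ℝ) 1} := by ext; simp [unitCube]
  rw [this]
  exact isClosed_iInter fun i => isClosed_Icc.preimage (EuclideanSpace.proj (𝕜 := ℝ) i).continuous

theorem measurableSet_unitCube (d : ℕ) : MeasurableSet (unitCube d) :=
  (isClosed_unitCube d).measurableSet

theorem unitCube_eq_preimage (d : ℕ) :
    unitCube d = WithLp.ofLp ⁻¹' (Set.univ.pi fun _ : Fin d => Icc (0 : ℝ) 1) := by
  ext; simp only [unitCube, mem_ofPred_eq, mem_preimage, mem_pi, mem_univ, forall_const]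

theorem setIntegral_unitCube_prod {d : ℕ} (φ : Fin d → ℝ → ℝ) :
    ∫ x in unitCube d, ∏ i, φ i (x i) = ∏ i, ∫ t in Icc (0 : ℝ) 1, φ i t := by
  have h := (EuclideanSpace.volume_preserving_symm_measurableEquiv_toLp
    (Fin d)).setIntegral_preimage_emb (MeasurableEquiv.measurableEmbedding _)
    (fun y : Fin d → ℝ => ∏ i, φ i (y i)) (Set.univ.pi fun _ : Fin d => Icc (0 : ℝ) 1)
  rw [unitCube_eq_preimage]
  refine Eq.trans h ?_
  rw [volume_pi, Measure.restrict_pi_pi, integral_fintype_prod_eq_prod]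

theorem volume_unitCube (d : ℕ) : volume (unitCube d) = 1 := by
  rw [unitCube_eq_preimage]
  have h := (EuclideanSpace.volume_preserving_symm_measurableEquiv_toLp
    (Fin d)).measure_preimage_equiv (Set.univ.pi fun _ : Fin d => Icc (0 : ℝ) 1)
  refine Eq.trans h ?_
  rw [volume_pi_pi]
  simp

theorem setIntegral_unitCube_prod_fejer {d N : ℕ} (hN : 0 < N) (b : Fin d → ℝ) :
    ∫ x in unitCube d, ∏ i, fejer N (x i - b i) = (1 / (N : ℝ)) ^ d := by
  rw [setIntegral_unitCube_prod (fun i t => fejer N (t - b i))]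
  simp_rw [integral_fejer_sub hN]
  simp

theorem isCompact_unitCube (d : ℕ) : IsCompact (unitCube d) := by
  rw [unitCube_eq_preimage]
  exact (PiLp.homeomorph (p := 2) (β := fun _ : Fin d => ℝ)).isCompact_preimage.2
    (isCompact_univ_pi fun _ => isCompact_Icc)

theorem Continuous.integrableOn_unitCube {d : ℕ} {f : EuclideanSpace ℝ (Fin d) → ℝ}
    (hf : Continuous f) : IntegrableOn f (unitCube d) :=
  hf.continuousOn.integrableOn_compact (isCompact_unitCube d)

theorem continuous_prod_fejer {d : ℕ} (N : ℕ) (b : Fin d → ℝ) :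
    Continuous fun x : EuclideanSpace ℝ (Fin d) => ∏ i, fejer N (x i - b i) := by
  refine continuous_finsetProd _ fun i _ => (continuous_fejer N).comp ?_
  exact (EuclideanSpace.proj (𝕜 := ℝ) i).continuous.sub continuous_const

/-- The integral of the Fejér kernel over a period ignores its centre, so the translation `v` is
free. Translates are needed because Riesz's formula produces them. -/
theorem setIntegral_abs_trigWave_le {d N : ℕ} (hN : 0 < N) (i₀ : Fin d) (c : Fin d → ℝ)
    (v : EuclideanSpace ℝ (Fin d)) :
    ∫ x in unitCube d, |trigWave N i₀ c (x + v)| ≤ (1 / (N : ℝ)) ^ d := by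
  rw [← setIntegral_unitCube_prod_fejer hN (fun i => c i - v i)]
  have hw := (partialRieszFormula_trigWave hN i₀ c).contDiff.continuous
  refine setIntegral_mono (Continuous.integrableOn_unitCube (by fun_prop))
    (continuous_prod_fejer N _).integrableOn_unitCube fun x => ?_
  refine (abs_trigWave_le _ _ _ _).trans_eq ?_
  refine Finset.prod_congr rfl fun i _ => ?_
  congr 1
  simp only [PiLp.add_apply]
  ring

theorem continuous_fderiv_single {d N : ℕ} {u : EuclideanSpace ℝ (Fin d) → ℝ}
    (hu : PartialRieszFormula N u) (i : Fin d) :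
    Continuous fun x => fderiv ℝ u x (EuclideanSpace.single i 1) :=
  (hu.partial_single i).contDiff.continuous

/-- Bernstein's inequality in L¹, from the same formula. -/
theorem setIntegral_abs_fderiv_trigWave_le {d N : ℕ} (hN : 0 < N) (i₀ : Fin d) (c : Fin d → ℝ) :
    ∫ x in unitCube d, |fderiv ℝ (trigWave N i₀ c) x (EuclideanSpace.single i₀ 1)| ≤
      4 * Real.pi * N * (1 / (N : ℝ)) ^ d := by
  have hw := (partialRieszFormula_trigWave hN i₀ c)
  have hwc := hw.contDiff.continuous
  have hcd := continuous_fderiv_single hw i₀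
  have hint : ∀ l ∈ Finset.range (4 * N), IntegrableOn (fun x => |rieszCoeff N l| *
        |trigWave N i₀ c (x + rieszNode N l • EuclideanSpace.single i₀ (1 : ℝ))|) (unitCube d) :=
    fun l _ => Continuous.integrableOn_unitCube (by fun_prop)
  calc _ ≤ ∫ x in unitCube d, ∑ l ∈ Finset.range (4 * N), |rieszCoeff N l| *
        |trigWave N i₀ c (x + rieszNode N l • EuclideanSpace.single i₀ (1 : ℝ))| := by
        refine setIntegral_mono (Continuous.integrableOn_unitCube (by fun_prop))
          (Continuous.integrableOn_unitCube (by fun_prop)) fun x => ?_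
        dsimp only
        rw [hw.fderiv_single]
        refine (Finset.abs_sum_le_sum_abs _ _).trans_eq ?_
        simp_rw [abs_mul]
    _ = ∑ l ∈ Finset.range (4 * N), |rieszCoeff N l| * ∫ x in unitCube d,
        |trigWave N i₀ c (x + rieszNode N l • EuclideanSpace.single i₀ (1 : ℝ))| := by
        rw [integral_finsetSum _ hint]
        simp_rw [integral_const_mul]
    _ ≤ ∑ l ∈ Finset.range (4 * N), |rieszCoeff N l| * (1 / (N : ℝ)) ^ d :=
        Finset.sum_le_sum fun l _ => mul_le_mul_of_nonneg_left
          (setIntegral_abs_trigWave_le hN i₀ c _) (abs_nonneg _)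
    _ ≤ _ := by
        rw [← Finset.sum_mul]
        exact mul_le_mul_of_nonneg_right (sum_abs_rieszCoeff_le hN) (by positivity)

/-- Sup norm times L¹ norm: with `A = 4πN`, the integrand without the square is at most `2A` and has
integral at most `2A N^(-d)`. -/
theorem setIntegral_sq_trigWave_le {d N : ℕ} (hN : 0 < N) (i₀ : Fin d) (c : Fin d → ℝ) :
    ∫ x in unitCube d, (4 * Real.pi * N * |trigWave N i₀ c x| +
        |fderiv ℝ (trigWave N i₀ c) x (EuclideanSpace.single i₀ 1)|) ^ 2 ≤
      4 * (4 * Real.pi * N) ^ 2 * (1 / (N : ℝ)) ^ d := by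
  have hw := (partialRieszFormula_trigWave hN i₀ c)
  have hwc := hw.contDiff.continuous
  have hcd := continuous_fderiv_single hw i₀
  have hi1 : IntegrableOn (fun x => 4 * Real.pi * N * |trigWave N i₀ c x|) (unitCube d) :=
    Continuous.integrableOn_unitCube (by fun_prop)
  have hi2 : IntegrableOn (fun x =>
      |fderiv ℝ (trigWave N i₀ c) x (EuclideanSpace.single i₀ 1)|) (unitCube d) :=
    Continuous.integrableOn_unitCube (by fun_prop)
  have h0 := setIntegral_abs_trigWave_le hN i₀ c 0
  simp only [add_zero] at h0
  have h1 := setIntegral_abs_fderiv_trigWave_le hN i₀ c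
  set A := 4 * Real.pi * N
  have hA : 0 ≤ A := by positivity
  calc _ ≤ ∫ x in unitCube d, 2 * A * (A * |trigWave N i₀ c x| +
        |fderiv ℝ (trigWave N i₀ c) x (EuclideanSpace.single i₀ 1)|) := by
        refine setIntegral_mono (Continuous.integrableOn_unitCube (by fun_prop))
          (Continuous.integrableOn_unitCube (by fun_prop)) fun x => ?_
        dsimp only
        rw [sq]
        refine mul_le_mul_of_nonneg_right ?_ (by positivity)
        have e1 := abs_trigWave_le_one hN i₀ c x
        have e2 := hw.abs_fderiv_single_le hN (abs_trigWave_le_one hN i₀ c) i₀ x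
        nlinarith
    _ = 2 * A * (A * ∫ x in unitCube d, |trigWave N i₀ c x|) + 2 * A * (∫ x in unitCube d,
        |fderiv ℝ (trigWave N i₀ c) x (EuclideanSpace.single i₀ 1)|) := by
        rw [integral_const_mul, integral_add hi1 hi2, integral_const_mul]
        ring
    _ ≤ 2 * A * (A * (1 / (N : ℝ)) ^ d) + 2 * A * (A * (1 / (N : ℝ)) ^ d) := by
        gcongr
    _ = _ := by ring

/-- In the direction `i₀` the falling kernel contributes at least `N / 8`, since the sine is at
least `1 / 2`, and the derivative of the sine takes away at most `2π < 6.3`. For `N ≥ 101` this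
leaves `N / 16`; each of the other factors is at least `1 / 2`. -/
theorem abs_fderiv_trigWave_ge {d N : ℕ} (hN : 101 ≤ N) (i₀ : Fin d) (c : Fin d → ℝ)
    {x : EuclideanSpace ℝ (Fin d)}
    (hx : ∀ i, x i - c i ∈ Icc (1 / (8 * N : ℝ)) (1 / (6 * N))) (hx₀ : x i₀ ∈ Icc (1 / 8 : ℝ) (1 / 4)) :
    (N : ℝ) / 16 * (1 / 2) ^ d ≤
      |fderiv ℝ (trigWave N i₀ c) x (EuclideanSpace.single i₀ 1)| := by
  have hN0 : 0 < N := by omega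
  have hNr : (101 : ℝ) ≤ N := by exact_mod_cast hN
  have hNp : (0 : ℝ) < N := by linarith
  have hder : HasDerivAt (fun t => (if i₀ = i₀ then Real.sin (2 * Real.pi * t) else 1) *
      fejer N (t - c i₀)) (2 * Real.pi * Real.cos (2 * Real.pi * x i₀) * fejer N (x i₀ - c i₀) +
      Real.sin (2 * Real.pi * x i₀) * deriv (fejer N) (x i₀ - c i₀)) (x i₀) := by
    simp only [if_true]
    have h3 : HasDerivAt (fun t : ℝ => 2 * Real.pi * t) (2 * Real.pi) (x i₀) := by
      simpa using (hasDerivAt_id (x i₀)).const_mul (2 * Real.pi)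
    have h4 : HasDerivAt (fun t : ℝ => fejer N (t - c i₀)) (deriv (fejer N) (x i₀ - c i₀)) (x i₀) := by
      apply HasDerivAt.comp_sub_const
      exact (hasDerivAt_fejer N _).differentiableAt.hasDerivAt
    exact (h3.sin.mul h4).congr_deriv (by ring)
  have hf := fderiv_prod_coord_single (rieszFormula_trigWave_factor hN0 i₀ c)
    i₀ x hder
  have hf' : fderiv ℝ (trigWave N i₀ c) x (EuclideanSpace.single i₀ 1) = _ := hf
  rw [hf', abs_mul]
  have hsin : 1 / 2 ≤ Real.sin (2 * Real.pi * x i₀) := by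
    have := Real.mul_le_sin (x := 2 * Real.pi * x i₀)
      (by have := hx₀.1; positivity) (by nlinarith [hx₀.2, Real.pi_pos])
    have e : 2 / Real.pi * (2 * Real.pi * x i₀) = 4 * x i₀ := by field_simp; ring
    linarith [hx₀.1]
  have hfd := deriv_fejer_le (N := N) (by omega) (hx i₀).1 ((hx i₀).2.trans (by
    gcongr; norm_num))
  have h1 : (N : ℝ) / 16 ≤ |2 * Real.pi * Real.cos (2 * Real.pi * x i₀) * fejer N (x i₀ - c i₀) +
      Real.sin (2 * Real.pi * x i₀) * deriv (fejer N) (x i₀ - c i₀)| := by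
    rw [le_abs]
    right
    have e1 : 2 * Real.pi * Real.cos (2 * Real.pi * x i₀) * fejer N (x i₀ - c i₀) ≤
        2 * Real.pi := by
      have := fejer_le_one hN0 (x i₀ - c i₀)
      have h0 := fejer_nonneg N (x i₀ - c i₀)
      have hc := Real.cos_le_one (2 * Real.pi * x i₀)
      have : Real.cos (2 * Real.pi * x i₀) * fejer N (x i₀ - c i₀) ≤ 1 := by nlinarith
      nlinarith [Real.pi_pos]
    have e2 : Real.sin (2 * Real.pi * x i₀) * deriv (fejer N) (x i₀ - c i₀) ≤ -(N / 8) := by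
      nlinarith
    linarith [Real.pi_lt_d2]
  have h2 : (1 / 2 : ℝ) ^ d ≤ |∏ j ∈ Finset.univ.erase i₀,
      ((if j = i₀ then Real.sin (2 * Real.pi * x j) else 1) * fejer N (x j - c j))| := by
    have e1 : ∏ j ∈ Finset.univ.erase i₀,
      ((if j = i₀ then Real.sin (2 * Real.pi * x j) else 1) * fejer N (x j - c j)) =
      ∏ j ∈ Finset.univ.erase i₀, fejer N (x j - c j) :=
      Finset.prod_congr rfl fun j hj => by rw [if_neg (Finset.ne_of_mem_erase hj), one_mul]
    rw [e1]
    refine le_trans ?_ (le_abs_self _)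
    calc (1 / 2 : ℝ) ^ d ≤ (1 / 2 : ℝ) ^ (Finset.univ.erase i₀).card :=
          pow_le_pow_of_le_one (by norm_num) (by norm_num)
            ((Finset.card_erase_le).trans (by simp))
      _ = ∏ j ∈ Finset.univ.erase i₀, (1 / 2 : ℝ) := by simp
      _ ≤ _ := Finset.prod_le_prod (fun _ _ => by norm_num) fun j _ => by
          refine fejer_ge_half hN0 ?_
          rw [abs_of_nonneg (le_trans (by positivity) (hx j).1)]
          exact (hx j).2
  exact mul_le_mul h1 h2 (by positivity) (abs_nonneg _)

/-! ### Shears of the cube and their densities. -/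

/-- The shear `x ↦ x + u(x) e` in the coordinate direction `e` of index `i₀`. -/
noncomputable def shear {d : ℕ} (i₀ : Fin d) (u : EuclideanSpace ℝ (Fin d) → ℝ)
    (x : EuclideanSpace ℝ (Fin d)) : EuclideanSpace ℝ (Fin d) :=
  x + u x • EuclideanSpace.single i₀ (1 : ℝ)

/-- A perturbation with small slopes that vanishes where the coordinate `x i₀` is `0` or `1`. -/
structure IsShearPerturbation {d : ℕ} (N : ℕ) (i₀ : Fin d) (τ : ℝ)
    (u : EuclideanSpace ℝ (Fin d) → ℝ) : Prop where
  pos : 0 < N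
  riesz : PartialRieszFormula N u
  bound : ∀ x, |u x| ≤ τ
  small : 4 * Real.pi * N * τ ≤ 1 / 2
  vanish : ∀ x, x i₀ = 0 ∨ x i₀ = 1 → u x = 0

theorem shear_apply_self {d : ℕ} (i₀ : Fin d) (u : EuclideanSpace ℝ (Fin d) → ℝ)
    (x : EuclideanSpace ℝ (Fin d)) : shear i₀ u x i₀ = x i₀ + u x := by
  simp [shear]

theorem shear_apply_ne {d : ℕ} {i₀ i : Fin d} (hi : i ≠ i₀) (u : EuclideanSpace ℝ (Fin d) → ℝ)
    (x : EuclideanSpace ℝ (Fin d)) : shear i₀ u x i = x i := by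
  simp [shear, hi]

theorem shear_apply {d : ℕ} (i₀ i : Fin d) (u : EuclideanSpace ℝ (Fin d) → ℝ)
    (x : EuclideanSpace ℝ (Fin d)) :
    shear i₀ u x i = x i + (if i = i₀ then 1 else 0) * u x := by
  split_ifs with h
  · subst h; rw [shear_apply_self, one_mul]
  · rw [shear_apply_ne h, zero_mul, add_zero]

namespace IsShearPerturbation

variable {d N : ℕ} {i₀ : Fin d} {τ : ℝ} {u v : EuclideanSpace ℝ (Fin d) → ℝ}

theorem tau_nonneg (hu : IsShearPerturbation N i₀ τ u) : 0 ≤ τ := (abs_nonneg _).trans (hu.bound 0)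

theorem abs_add_smul_sub_le (hu : IsShearPerturbation N i₀ τ u) (x : EuclideanSpace ℝ (Fin d))
    (s : ℝ) : |u (x + s • EuclideanSpace.single i₀ (1 : ℝ)) - u x| ≤ |s| / 2 := by
  have h1 := hu.riesz.abs_add_smul_single_sub_le hu.pos hu.bound x i₀ s
  have := mul_le_mul_of_nonneg_right hu.small (abs_nonneg s)
  linarith

/-- Both shears move points along the same axis, so the preimages of a point differ by some `s`
along it. The slope bound gives `|s| ≤ |v x - u x| + |s| / 2`. The case `u = v` is injectivity. -/
theorem exists_eq_add_smul (hu : IsShearPerturbation N i₀ τ u) {x y : EuclideanSpace ℝ (Fin d)}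
    (h : shear i₀ u y = shear i₀ v x) :
    ∃ s : ℝ, y = x + s • EuclideanSpace.single i₀ (1 : ℝ) ∧ |s| ≤ 2 * |v x - u x| := by
  have h1 : y = x + (v x - u y) • EuclideanSpace.single i₀ (1 : ℝ) := by
    rw [shear, shear] at h
    rw [sub_smul, ← add_sub_assoc, ← h, add_sub_cancel_right]
  refine ⟨v x - u y, h1, ?_⟩
  have h2 := hu.abs_add_smul_sub_le x (v x - u y)
  rw [← h1] at h2
  have h3 : |v x - u y| ≤ |v x - u x| + |u y - u x| := by
    have : v x - u y = (v x - u x) - (u y - u x) := by ring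
    rw [this]
    exact abs_sub _ _
  linarith

theorem injective (hu : IsShearPerturbation N i₀ τ u) : Function.Injective (shear i₀ u) := by
  intro y x h
  obtain ⟨s, hs, hs'⟩ := hu.exists_eq_add_smul h
  rw [sub_self, abs_zero, mul_zero] at hs'
  rw [abs_nonpos_iff.1 hs'] at hs
  simpa using hs

theorem surjective (hu : IsShearPerturbation N i₀ τ u) : Function.Surjective (shear i₀ u) := by
  intro z
  have huc := hu.riesz.contDiff.continuous
  have hc : Continuous fun s : ℝ => s + u (z + s • EuclideanSpace.single i₀ (1 : ℝ)) := by
    fun_prop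
  have h := intermediate_value_Icc (by linarith [hu.tau_nonneg] : -τ ≤ τ) hc.continuousOn
  obtain ⟨s, -, hs⟩ := h (show (0 : ℝ) ∈ _ from
    ⟨by linarith [(abs_le.1 (hu.bound (z + (-τ) • EuclideanSpace.single i₀ (1 : ℝ)))).2],
      by linarith [(abs_le.1 (hu.bound (z + τ • EuclideanSpace.single i₀ (1 : ℝ)))).1]⟩)
  refine ⟨z + s • EuclideanSpace.single i₀ (1 : ℝ), ?_⟩
  dsimp only at hs
  rw [shear, add_assoc, ← add_smul, hs, zero_smul, add_zero]

theorem abs_le_of_vanish (hu : IsShearPerturbation N i₀ τ u) (x : EuclideanSpace ℝ (Fin d)) {b : ℝ}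
    (hb : b = 0 ∨ b = 1) : |u x| ≤ |b - x i₀| / 2 := by
  have h := hu.abs_add_smul_sub_le x (b - x i₀)
  rw [hu.vanish (x + (b - x i₀) • EuclideanSpace.single i₀ (1 : ℝ)) (by simpa using hb)] at h
  simpa using h

/-- As `u` vanishes on both face hyperplanes and has slope at most `1 / 2`, a point moves by at most
half its distance to either of them and crosses neither. -/
theorem mem_unitCube_iff (hu : IsShearPerturbation N i₀ τ u) (x : EuclideanSpace ℝ (Fin d)) :
    shear i₀ u x ∈ unitCube d ↔ x ∈ unitCube d := by
  have h0 := hu.abs_le_of_vanish x (Or.inl rfl)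
  have h1 := hu.abs_le_of_vanish x (Or.inr rfl)
  have key : shear i₀ u x i₀ ∈ Icc (0 : ℝ) 1 ↔ x i₀ ∈ Icc (0 : ℝ) 1 := by
    rw [shear_apply_self, mem_Icc, mem_Icc]
    rw [abs_le] at h0 h1
    constructor
    · rintro ⟨h2, h3⟩
      constructor
      · by_contra! h
        rw [abs_of_nonneg (by linarith)] at h0
        linarith
      · by_contra! h
        rw [abs_of_nonpos (by linarith)] at h1
        linarith
    · rintro ⟨h2, h3⟩
      rw [abs_of_nonpos (by linarith)] at h0
      rw [abs_of_nonneg (by linarith)] at h1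
      constructor <;> linarith
  constructor
  · intro h i
    by_cases hi : i = i₀
    · subst hi; exact key.1 (h i)
    · rw [← shear_apply_ne hi u]; exact h i
  · intro h i
    by_cases hi : i = i₀
    · subst hi; exact key.2 (h i)
    · rw [shear_apply_ne hi u]; exact h i

theorem image_unitCube (hu : IsShearPerturbation N i₀ τ u) :
    shear i₀ u '' unitCube d = unitCube d := by
  ext z
  constructor
  · rintro ⟨x, hx, rfl⟩; exact (hu.mem_unitCube_iff x).2 hx
  · intro hz
    obtain ⟨x, rfl⟩ := hu.surjective z
    exact ⟨x, (hu.mem_unitCube_iff x).1 hz, rfl⟩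

theorem bijOn_unitCube (hu : IsShearPerturbation N i₀ τ u) :
    BijOn (shear i₀ u) (unitCube d) (unitCube d) :=
  ⟨fun x hx => (hu.mem_unitCube_iff x).2 hx, hu.injective.injOn, hu.image_unitCube.superset⟩

theorem hasFDerivAt (hu : IsShearPerturbation N i₀ τ u) (x : EuclideanSpace ℝ (Fin d)) :
    HasFDerivAt (shear i₀ u) (ContinuousLinearMap.id ℝ (EuclideanSpace ℝ (Fin d)) +
      (fderiv ℝ u x).smulRight (EuclideanSpace.single i₀ (1 : ℝ))) x :=
  (hasFDerivAt_id x).add ((hu.riesz.differentiable x).hasFDerivAt.smul_const _)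

theorem _root_.det_id_add_smulRight {E : Type*} [NormedAddCommGroup E] [NormedSpace ℝ E]
    [FiniteDimensional ℝ E] (f : E →L[ℝ] ℝ) (v : E) :
    (ContinuousLinearMap.id ℝ E + f.smulRight v).det = 1 + f v :=
  LinearMap.transvection.det (f : E →ₗ[ℝ] ℝ) v

theorem abs_slope_le (hu : IsShearPerturbation N i₀ τ u) (x : EuclideanSpace ℝ (Fin d)) :
    |fderiv ℝ u x (EuclideanSpace.single i₀ 1)| ≤ 1 / 2 :=
  (hu.riesz.abs_fderiv_single_le hu.pos hu.bound i₀ x).trans hu.small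

theorem le_jacobian (hu : IsShearPerturbation N i₀ τ u) (x : EuclideanSpace ℝ (Fin d)) :
    1 / 2 ≤ 1 + fderiv ℝ u x (EuclideanSpace.single i₀ 1) := by
  linarith [(abs_le.1 (hu.abs_slope_le x)).1]

theorem jacobian_le (hu : IsShearPerturbation N i₀ τ u) (x : EuclideanSpace ℝ (Fin d)) :
    1 + fderiv ℝ u x (EuclideanSpace.single i₀ 1) ≤ 3 / 2 := by
  linarith [(abs_le.1 (hu.abs_slope_le x)).2]

theorem abs_det (hu : IsShearPerturbation N i₀ τ u) (x : EuclideanSpace ℝ (Fin d)) :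
    |(ContinuousLinearMap.id ℝ (EuclideanSpace ℝ (Fin d)) +
      (fderiv ℝ u x).smulRight (EuclideanSpace.single i₀ (1 : ℝ))).det| =
      1 + fderiv ℝ u x (EuclideanSpace.single i₀ 1) := by
  rw [det_id_add_smulRight, abs_of_pos]
  linarith [hu.le_jacobian x]

theorem setIntegral_image (hu : IsShearPerturbation N i₀ τ u) {s : Set (EuclideanSpace ℝ (Fin d))}
    (hs : MeasurableSet s) (f : EuclideanSpace ℝ (Fin d) → ℝ) :
    ∫ x in shear i₀ u '' s, f x =
      ∫ y in s, (1 + fderiv ℝ u y (EuclideanSpace.single i₀ 1)) * f (shear i₀ u y) := by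
  rw [integral_image_eq_integral_abs_det_fderiv_smul volume hs
    (fun x _ => (hu.hasFDerivAt x).hasFDerivWithinAt) hu.injective.injOn]
  simp_rw [hu.abs_det, smul_eq_mul]

theorem setLIntegral_image (hu : IsShearPerturbation N i₀ τ u)
    {s : Set (EuclideanSpace ℝ (Fin d))} (hs : MeasurableSet s)
    (f : EuclideanSpace ℝ (Fin d) → ℝ≥0∞) :
    ∫⁻ x in shear i₀ u '' s, f x = ∫⁻ y in s,
      ENNReal.ofReal (1 + fderiv ℝ u y (EuclideanSpace.single i₀ 1)) * f (shear i₀ u y) := by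
  rw [lintegral_image_eq_lintegral_abs_det_fderiv_mul volume hs
    (fun x _ => (hu.hasFDerivAt x).hasFDerivWithinAt) hu.injective.injOn]
  simp_rw [hu.abs_det]

end IsShearPerturbation

/-- The density of the image of Lebesgue measure under the shear `x ↦ x + u(x) e`. -/
noncomputable def shearDensity {d : ℕ} (i₀ : Fin d) (u : EuclideanSpace ℝ (Fin d) → ℝ)
    (x : EuclideanSpace ℝ (Fin d)) : ℝ :=
  (1 + fderiv ℝ u (Function.invFun (shear i₀ u) x) (EuclideanSpace.single i₀ 1))⁻¹

namespace IsShearPerturbation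

variable {d N : ℕ} {i₀ : Fin d} {τ : ℝ} {u v : EuclideanSpace ℝ (Fin d) → ℝ}

theorem shearDensity_shear (hu : IsShearPerturbation N i₀ τ u) (y : EuclideanSpace ℝ (Fin d)) :
    shearDensity i₀ u (shear i₀ u y) =
      (1 + fderiv ℝ u y (EuclideanSpace.single i₀ 1))⁻¹ := by
  rw [shearDensity, Function.leftInverse_invFun hu.injective y]

theorem measurable_shearDensity (hu : IsShearPerturbation N i₀ τ u) :
    Measurable (shearDensity i₀ u) := by
  have hc : Continuous (shear i₀ u) :=
    continuous_iff_continuousAt.2 fun x => (hu.hasFDerivAt x).continuousAt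
  have hemb : MeasurableEmbedding (shear i₀ u) := hc.measurableEmbedding hu.injective
  have hg : Measurable fun y => (1 + fderiv ℝ u y (EuclideanSpace.single i₀ 1))⁻¹ :=
    (measurable_const.add (continuous_fderiv_single hu.riesz i₀).measurable).inv
  -- The density is only explicit at image points. The shear is a measurable embedding, so that
  -- formula extends measurably, and surjectivity makes the extension the density itself.
  obtain ⟨f, hf, hfg⟩ := hemb.exists_measurable_extend hg fun _ => ⟨0⟩
  have : shearDensity i₀ u = f := by
    funext x
    obtain ⟨y, rfl⟩ := hu.surjective x
    rw [hu.shearDensity_shear]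
    exact (congrFun hfg y).symm
  rwa [this]

theorem shearDensity_bounds (hu : IsShearPerturbation N i₀ τ u) (x : EuclideanSpace ℝ (Fin d)) :
    2 / 3 ≤ shearDensity i₀ u x ∧ shearDensity i₀ u x ≤ 2 := by
  have h1 := hu.le_jacobian (Function.invFun (shear i₀ u) x)
  have h2 := hu.jacobian_le (Function.invFun (shear i₀ u) x)
  rw [shearDensity]
  constructor
  · rw [show (2 / 3 : ℝ) = (3 / 2)⁻¹ by norm_num]
    exact inv_anti₀ (by linarith) h2
  · rw [show (2 : ℝ) = (1 / 2)⁻¹ by norm_num]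
    exact inv_anti₀ (by norm_num) h1

theorem shearDensity_pos (hu : IsShearPerturbation N i₀ τ u) (x : EuclideanSpace ℝ (Fin d)) :
    0 < shearDensity i₀ u x := by linarith [(hu.shearDensity_bounds x).1]

theorem setIntegral_shearDensity (hu : IsShearPerturbation N i₀ τ u) :
    ∫ x in unitCube d, shearDensity i₀ u x = 1 := by
  have h := hu.setIntegral_image (measurableSet_unitCube d) (shearDensity i₀ u)
  rw [hu.image_unitCube] at h
  rw [h]
  have : ∀ y, (1 + fderiv ℝ u y (EuclideanSpace.single i₀ 1)) *
      shearDensity i₀ u (shear i₀ u y) = 1 := by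
    intro y
    rw [hu.shearDensity_shear]
    exact mul_inv_cancel₀ (by linarith [hu.le_jacobian y])
  simp [this, Measure.real, volume_unitCube]

theorem isCubeDensity (hu : IsShearPerturbation N i₀ τ u) : IsCubeDensity (shearDensity i₀ u) :=
  ⟨fun x _ => (hu.shearDensity_pos x).le, hu.setIntegral_shearDensity⟩

/-- Bernstein's inequality for the slope of `u`, over the displacement between the two preimages.
The result is of second order in the amplitude. -/
theorem abs_slope_sub_le (hu : IsShearPerturbation N i₀ τ u) {x y : EuclideanSpace ℝ (Fin d)}
    (h : shear i₀ u y = shear i₀ v x) :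
    |fderiv ℝ u y (EuclideanSpace.single i₀ 1) - fderiv ℝ u x (EuclideanSpace.single i₀ 1)| ≤
      2 * (4 * Real.pi * N * τ) * (4 * Real.pi * N * |v x - u x|) := by
  obtain ⟨s, rfl, hs⟩ := hu.exists_eq_add_smul h
  have h1 := (hu.riesz.partial_single i₀).abs_add_smul_single_sub_le hu.pos
    (hu.riesz.abs_fderiv_single_le hu.pos hu.bound i₀) x i₀ s
  have hτ := hu.tau_nonneg
  calc _ ≤ _ := h1
    _ ≤ 4 * Real.pi * N * (4 * Real.pi * N * τ) * (2 * |v x - u x|) := by gcongr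
    _ = _ := by ring

/-- Both densities are evaluated at one point, whose preimages under the two shears differ. The
slope error from this shift carries the factor `2 * (4πNτ) ≤ 1`; the factor `4` bounds the inverse
product of the Jacobians. -/
theorem abs_shearDensity_sub_le (hu : IsShearPerturbation N i₀ τ u)
    (hv : IsShearPerturbation N i₀ τ v) (x : EuclideanSpace ℝ (Fin d)) :
    |shearDensity i₀ v (shear i₀ v x) - shearDensity i₀ u (shear i₀ v x)| ≤
      4 * (4 * Real.pi * N * |v x - u x| + |fderiv ℝ v x (EuclideanSpace.single i₀ 1) -
        fderiv ℝ u x (EuclideanSpace.single i₀ 1)|) := by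
  obtain ⟨y, hy⟩ := hu.surjective (shear i₀ v x)
  have h1 := hu.abs_slope_sub_le hy
  rw [hv.shearDensity_shear, ← hy, hu.shearDensity_shear]
  have h2 := hv.le_jacobian x
  have h3 := hu.le_jacobian y
  set a := fderiv ℝ v x (EuclideanSpace.single i₀ 1)
  set b := fderiv ℝ u y (EuclideanSpace.single i₀ 1)
  set e := fderiv ℝ u x (EuclideanSpace.single i₀ 1)
  rw [inv_sub_inv (by linarith) (by linarith), abs_div, div_le_iff₀ (abs_pos.2 (by positivity)),
    abs_of_pos (by positivity : 0 < (1 + a) * (1 + b))]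
  have h4 : |1 + b - (1 + a)| ≤ |b - e| + |a - e| := by
    have : 1 + b - (1 + a) = (b - e) - (a - e) := by ring
    rw [this]; exact abs_sub _ _
  have h5 : 2 * (4 * Real.pi * N * τ) * (4 * Real.pi * N * |v x - u x|) ≤
      4 * Real.pi * N * |v x - u x| := by
    have := mul_le_mul_of_nonneg_right hu.small
      (by positivity : 0 ≤ 4 * Real.pi * N * |v x - u x|)
    linarith
  have h6 : 1 / 4 ≤ (1 + a) * (1 + b) := by nlinarith
  have h7 : 0 ≤ 4 * Real.pi * N * |v x - u x| + |a - e| := by positivity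
  nlinarith

/-- Here the second-order shift error is kept explicit, so that a small `τ` makes it negligible
against the difference of slopes. -/
theorem le_abs_shearDensity_sub (hu : IsShearPerturbation N i₀ τ u)
    (hv : IsShearPerturbation N i₀ τ v) (x : EuclideanSpace ℝ (Fin d)) :
    (|fderiv ℝ v x (EuclideanSpace.single i₀ 1) - fderiv ℝ u x (EuclideanSpace.single i₀ 1)| -
      2 * (4 * Real.pi * N * τ) * (4 * Real.pi * N * |v x - u x|)) / 4 ≤
    |shearDensity i₀ v (shear i₀ v x) - shearDensity i₀ u (shear i₀ v x)| := by
  obtain ⟨y, hy⟩ := hu.surjective (shear i₀ v x)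
  have h1 := hu.abs_slope_sub_le hy
  rw [hv.shearDensity_shear, ← hy, hu.shearDensity_shear]
  have h2 := hv.le_jacobian x
  have h3 := hu.le_jacobian y
  have h2' := hv.jacobian_le x
  have h3' := hu.jacobian_le y
  set a := fderiv ℝ v x (EuclideanSpace.single i₀ 1)
  set b := fderiv ℝ u y (EuclideanSpace.single i₀ 1)
  set e := fderiv ℝ u x (EuclideanSpace.single i₀ 1)
  rw [inv_sub_inv (by linarith) (by linarith), abs_div, le_div_iff₀ (abs_pos.2 (by positivity)),
    abs_of_pos (by positivity : 0 < (1 + a) * (1 + b))]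
  have h4 : |a - e| ≤ |1 + b - (1 + a)| + |b - e| := by
    have : a - e = (b - e) - (1 + b - (1 + a)) := by ring
    rw [this]; linarith [abs_sub (b - e) (1 + b - (1 + a))]
  have h6 : (1 + a) * (1 + b) ≤ 4 := by nlinarith
  have h7 : 0 ≤ (1 + a) * (1 + b) := by positivity
  have h8 := abs_nonneg (1 + b - (1 + a))
  set D := |a - e| - 2 * (4 * Real.pi * N * τ) * (4 * Real.pi * N * |v x - u x|)
  have h9 : D ≤ |1 + b - (1 + a)| := by simp only [D]; linarith
  rcases le_total D 0 with h | h
  · have : D / 4 * ((1 + a) * (1 + b)) ≤ 0 := mul_nonpos_of_nonpos_of_nonneg (by linarith) h7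
    linarith
  · nlinarith

end IsShearPerturbation

/-! ### The shears belong to the Hölder class. -/

theorem uniqueDiffOn_unitCube (d : ℕ) : UniqueDiffOn ℝ (unitCube d) := by
  refine uniqueDiffOn_convex ?_ ?_
  · intro x hx y hy a b ha hb hab i
    have := (convex_Icc (0 : ℝ) 1) (hx i) (hy i) ha hb hab
    simpa using this
  · have hopen : IsOpen {x : EuclideanSpace ℝ (Fin d) | ∀ i, x i ∈ Ioo (0 : ℝ) 1} := by
      have : {x : EuclideanSpace ℝ (Fin d) | ∀ i, x i ∈ Ioo (0 : ℝ) 1} =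
        ⋂ i, {x | x i ∈ Ioo (0 : ℝ) 1} := by ext; simp
      rw [this]
      exact isOpen_iInter_of_finite fun i =>
        isOpen_Ioo.preimage (EuclideanSpace.proj (𝕜 := ℝ) i).continuous
    refine ⟨WithLp.toLp 2 fun _ => 1 / 2, interior_maximal (fun x hx i => ⟨(hx i).1.le, (hx i).2.le⟩)
      hopen ?_⟩
    intro i
    norm_num

theorem iteratedFDeriv_continuousLinearMap_of_two_le {E : Type*} [NormedAddCommGroup E]
    [NormedSpace ℝ E] (f : E →L[ℝ] ℝ) {k : ℕ} (hk : 2 ≤ k) (x : E) :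
    iteratedFDeriv ℝ k f x = 0 := by
  obtain ⟨k, rfl⟩ := Nat.exists_eq_add_of_le' hk
  ext m
  rw [iteratedFDeriv_succ_apply_right]
  have : (fun y => fderiv ℝ f y) = fun _ => f := by funext y; exact f.fderiv
  rw [this, iteratedFDeriv_const_of_ne (by omega)]
  rfl

namespace IsShearPerturbation

variable {d N : ℕ} {i₀ : Fin d} {τ : ℝ} {u : EuclideanSpace ℝ (Fin d) → ℝ}

theorem contDiff_shear (hu : IsShearPerturbation N i₀ τ u) :
    ContDiff ℝ ((⊤ : ℕ∞) : WithTop ℕ∞) (shear i₀ u) :=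
  contDiff_id.add (hu.riesz.contDiff.smul contDiff_const)

theorem partialDeriv_shear (hu : IsShearPerturbation N i₀ τ u) {k : ℕ} (ι : Fin k → Fin d)
    (i : Fin d) {x : EuclideanSpace ℝ (Fin d)} (hx : x ∈ unitCube d) :
    partialDeriv (unitCube d) (shear i₀ u) ι i x =
      iteratedFDeriv ℝ k (EuclideanSpace.proj (𝕜 := ℝ) i : EuclideanSpace ℝ (Fin d) →L[ℝ] ℝ) x
        (fun j => EuclideanSpace.single (ι j) (1 : ℝ)) +
      (if i = i₀ then 1 else 0) *
        iteratedFDeriv ℝ k u x (fun j => EuclideanSpace.single (ι j) (1 : ℝ)) := by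
  have hle : ((k : ℕ) : WithTop ℕ∞) ≤ ((⊤ : ℕ∞) : WithTop ℕ∞) := by exact_mod_cast le_top
  rw [partialDeriv, iteratedFDerivWithin_eq_iteratedFDeriv (uniqueDiffOn_unitCube d)
    (hu.contDiff_shear.of_le hle).contDiffAt hx]
  have h1 := (EuclideanSpace.proj (𝕜 := ℝ) i :
    EuclideanSpace ℝ (Fin d) →L[ℝ] ℝ).iteratedFDeriv_comp_left (f := shear i₀ u) (x := x) (i := k)
      (n := k) (hu.contDiff_shear.of_le hle).contDiffAt le_rfl
  have h2 : (EuclideanSpace.proj (𝕜 := ℝ) i : EuclideanSpace ℝ (Fin d) →L[ℝ] ℝ) ∘ shear i₀ u =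
      (EuclideanSpace.proj (𝕜 := ℝ) i : EuclideanSpace ℝ (Fin d) →L[ℝ] ℝ) +
        (if i = i₀ then (1 : ℝ) else 0) • u := by
    funext y
    exact shear_apply i₀ i u y
  have hcu : ContDiffAt ℝ k ((if i = i₀ then (1 : ℝ) else 0) • u) x :=
    ContDiffAt.const_smul (if i = i₀ then (1 : ℝ) else 0)
      (hu.riesz.contDiff.of_le hle).contDiffAt (x := x)
  rw [h2, iteratedFDeriv_add_apply ((ContinuousLinearMap.contDiff _).contDiffAt) hcu,
    iteratedFDeriv_const_smul_apply (hu.riesz.contDiff.of_le hle).contDiffAt] at h1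
  have h3 := congrArg (fun F => F (fun j => EuclideanSpace.single (ι j) (1 : ℝ))) h1
  exact h3.symm

theorem mem_holderBall (hu : IsShearPerturbation N i₀ τ u) {β H : ℝ} (hβ : 2 < β)
    (hH : 1 + 4 * Real.pi * N * τ ≤ H)
    (hτ : 2 * d * (4 * Real.pi * N) ^ (1 + β) * τ ≤ 1) :
    shear i₀ u ∈ holderBall (1 + β) (unitCube d) H := by
  have hd : 1 ≤ d := Fin.pos i₀
  have hdr : (1 : ℝ) ≤ d := by exact_mod_cast hd
  have hN : (1 : ℝ) ≤ N := by exact_mod_cast hu.pos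
  have hA : 1 ≤ 4 * Real.pi * N := by nlinarith [Real.pi_gt_three]
  have hτ0 := hu.tau_nonneg
  have hH1 : 1 ≤ H := le_trans (by nlinarith) hH
  have hs1 : ((strictFloor (1 + β) : ℕ) : ℝ) + 1 = ⌈1 + β⌉₊ := by
    have : 0 < ⌈1 + β⌉₊ := Nat.ceil_pos.2 (by linarith)
    rw [strictFloor]
    exact_mod_cast Nat.sub_add_cancel this
  have hs2 := Nat.le_ceil (1 + β)
  have hs3 := Nat.ceil_lt_add_one (show 0 ≤ 1 + β by linarith)
  rw [← hs1] at hs2 hs3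
  set s := strictFloor (1 + β)
  have hsge : 2 ≤ s := by
    have : (1 : ℝ) < s := by linarith
    exact_mod_cast this
  set A := 4 * Real.pi * N with hAdef
  have hA0 : 0 < A := by linarith
  have hp : A ^ (1 + β) * τ ≤ 1 := by
    have : 0 ≤ A ^ (1 + β) * τ := by positivity
    nlinarith
  have hp2 : 2 * (A ^ (1 + β) * τ) ≤ 1 := by
    have : 0 ≤ A ^ (1 + β) * τ := by positivity
    nlinarith
  refine ⟨(hu.contDiff_shear.of_le (by exact_mod_cast le_top)).contDiffOn, ?_, ?_⟩
  · intro k hk ι i x hx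
    have hub := (hu.riesz.iteratedFDeriv_single hu.pos hu.bound ι).2 x
    -- The identity part of the shear matters only for orders `0` and `1`. Order `0` is bounded
    -- because the cube is preserved; order `1` is where `H > 1` is used up.
    rcases Nat.lt_or_ge k 2 with hk2 | hk2
    · interval_cases k
      · have h1 : partialDeriv (unitCube d) (shear i₀ u) ι i x = shear i₀ u x i := by
          simp [partialDeriv]
        have h2 := (hu.mem_unitCube_iff x).2 hx i
        rw [h1, abs_of_nonneg h2.1]
        exact h2.2.trans hH1
      · rw [hu.partialDeriv_shear ι i hx]
        refine (abs_add_le _ _).trans (le_trans (add_le_add ?_ ?_) hH)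
        · rw [iteratedFDeriv_succ_apply_right]
          simp only [iteratedFDeriv_zero_apply, ContinuousLinearMap.fderiv]
          change |(EuclideanSpace.single (ι (Fin.last 0)) (1 : ℝ)) i| ≤ 1
          rw [PiLp.single_apply]
          split_ifs <;> simp
        · rw [abs_mul]
          refine (mul_le_of_le_one_left (abs_nonneg _) ?_).trans (hub.trans_eq (by rw [hAdef, pow_one]))
          split_ifs <;> simp
    · rw [hu.partialDeriv_shear ι i hx, iteratedFDeriv_continuousLinearMap_of_two_le _ hk2]
      simp only [zero_apply, zero_add]
      rw [abs_mul]
      refine (mul_le_of_le_one_left (abs_nonneg _) ?_).trans (hub.trans (le_trans ?_ hH1))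
      · split_ifs <;> simp
      · refine le_trans (mul_le_mul_of_nonneg_right ?_ hτ0) hp
        rw [← Real.rpow_natCast]
        refine Real.rpow_le_rpow_of_exponent_le hA ?_
        have : (k : ℝ) ≤ s := by exact_mod_cast hk
        linarith
  · intro ι i x hx y hy
    obtain ⟨hr, hub⟩ := hu.riesz.iteratedFDeriv_single hu.pos hu.bound ι
    have hlip := hr.abs_sub_le hu.pos hub x y
    rw [hu.partialDeriv_shear ι i hx, hu.partialDeriv_shear ι i hy,
      iteratedFDeriv_continuousLinearMap_of_two_le _ hsge,
      iteratedFDeriv_continuousLinearMap_of_two_le _ hsge]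
    simp only [zero_apply, zero_add]
    rw [← mul_sub, abs_mul]
    refine (mul_le_of_le_one_left (abs_nonneg _) (by split_ifs <;> simp)).trans ?_
    have hxb := hub x
    have hyb := hub y
    rw [← hAdef] at hlip hxb hyb
    set δ := 1 + β - (s : ℝ) with hδ
    have hδ0 : 0 < δ := by linarith
    have hδ1 : δ ≤ 1 := by linarith
    have hpow : A ^ s * A ^ δ = A ^ (1 + β) := by
      rw [← Real.rpow_natCast, ← Real.rpow_add hA0]; congr 1; rw [hδ]; ring
    set t := ‖x - y‖
    have ht0 : 0 ≤ t := norm_nonneg _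
    have hm0 : 0 ≤ min 1 t := le_min zero_le_one ht0
    have hgoal : |iteratedFDeriv ℝ s u x (fun j => EuclideanSpace.single (ι j) (1 : ℝ)) -
        iteratedFDeriv ℝ s u y (fun j => EuclideanSpace.single (ι j) (1 : ℝ))| ≤
        (min 1 t) ^ δ := by
      -- The wavelength scale `1 / A` separates two regimes. Far apart, the sup bound `2 A^s τ` is
      -- compared with `A^(-δ)`; close together, the Lipschitz bound is combined with `A t ≤ (A
      -- t)^δ`. Both consume `A^(s+δ) τ = A^(1+β) τ`.
      rcases le_total (1 / A) t with h | h
      · have h1 : 1 / A ≤ min 1 t := le_min (by rw [div_le_one hA0]; exact hA) h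
        have h2 : (1 / A) ^ δ ≤ (min 1 t) ^ δ := Real.rpow_le_rpow (by positivity) h1 hδ0.le
        refine le_trans ?_ h2
        rw [one_div, Real.inv_rpow hA0.le, ← one_div, le_div_iff₀ (by positivity)]
        have h3 := (abs_sub (iteratedFDeriv ℝ s u x (fun j => EuclideanSpace.single (ι j) (1 : ℝ)))
          (iteratedFDeriv ℝ s u y (fun j => EuclideanSpace.single (ι j) (1 : ℝ)))).trans
            (add_le_add hxb hyb)
        calc _ ≤ (A ^ s * τ + A ^ s * τ) * A ^ δ := by gcongr
          _ = 2 * ((A ^ s * A ^ δ) * τ) := by ring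
          _ ≤ 1 := by rw [hpow]; exact hp2
      · have h1 : t ≤ 1 := h.trans (by rw [div_le_one hA0]; exact hA)
        rw [min_eq_right h1]
        have hAt : A * t ≤ 1 := by rwa [le_div_iff₀ hA0, mul_comm] at h
        have h2 : A * t ≤ (A * t) ^ δ := by
          conv_lhs => rw [← Real.rpow_one (A * t)]
          exact Real.rpow_le_rpow_of_exponent_ge' (by positivity) hAt hδ0.le hδ1
        rw [Real.mul_rpow hA0.le ht0] at h2
        calc _ ≤ d * (A * (A ^ s * τ)) * t := hlip
          _ = d * (A ^ s * τ) * (A * t) := by ring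
          _ ≤ d * (A ^ s * τ) * (A ^ δ * t ^ δ) := by gcongr
          _ = d * ((A ^ s * A ^ δ) * τ) * t ^ δ := by ring
          _ ≤ 1 * t ^ δ := by
              rw [hpow]
              gcongr
              have : 0 ≤ d * (A ^ (1 + β) * τ) := by positivity
              nlinarith
          _ = t ^ δ := one_mul _
    refine hgoal.trans (le_mul_of_one_le_left (by positivity) hH1)

theorem fderivWithin_shear (hu : IsShearPerturbation N i₀ τ u) {x : EuclideanSpace ℝ (Fin d)}
    (hx : x ∈ unitCube d) : fderivWithin ℝ (shear i₀ u) (unitCube d) x =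
      ContinuousLinearMap.id ℝ (EuclideanSpace ℝ (Fin d)) +
        (fderiv ℝ u x).smulRight (EuclideanSpace.single i₀ (1 : ℝ)) :=
  (hu.hasFDerivAt x).hasFDerivWithinAt.fderivWithin (uniqueDiffOn_unitCube d x hx)

theorem shearDensity_mem (hu : IsShearPerturbation N i₀ τ u) {β Λ H : ℝ} (hβ : 2 < β)
    (hH : 1 + 4 * Real.pi * N * τ ≤ H) (hτ : 2 * d * (4 * Real.pi * N) ^ (1 + β) * τ ≤ 1)
    (hΛ : 1 < Λ) (hΛ1 : Λ⁻¹ ≤ 1 - d * (4 * Real.pi * N * τ))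
    (hΛ2 : 1 + d * (4 * Real.pi * N * τ) ≤ Λ) :
    shearDensity i₀ u ∈ smoothTransportDensities d β Λ H := by
  refine ⟨shear i₀ u, ⟨hu.mem_holderBall hβ hH hτ, ?_⟩, hu.bijOn_unitCube, ?_⟩
  · intro x hx v
    rw [hu.fderivWithin_shear hx]
    have h1 := hu.riesz.abs_fderiv_le hu.pos hu.bound x v
    have h2 : ‖(fderiv ℝ u x v) • EuclideanSpace.single i₀ (1 : ℝ)‖ ≤
        d * (4 * Real.pi * N * τ) * ‖v‖ := by
      rw [norm_smul, PiLp.norm_single, norm_one, mul_one]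
      exact h1
    have e : (ContinuousLinearMap.id ℝ (EuclideanSpace ℝ (Fin d)) +
        (fderiv ℝ u x).smulRight (EuclideanSpace.single i₀ (1 : ℝ))) v =
        v + (fderiv ℝ u x v) • EuclideanSpace.single i₀ (1 : ℝ) := rfl
    rw [e, ← mul_pow, ← mul_pow]
    have hΛ0 : 0 < Λ⁻¹ := by positivity
    have h3 := norm_nonneg v
    constructor
    · refine pow_le_pow_left₀ (by positivity) ?_ 2
      have := norm_sub_le_norm_add v ((fderiv ℝ u x v) • EuclideanSpace.single i₀ (1 : ℝ))
      nlinarith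
    · refine pow_le_pow_left₀ (norm_nonneg _) ?_ 2
      have := norm_add_le v ((fderiv ℝ u x v) • EuclideanSpace.single i₀ (1 : ℝ))
      nlinarith
  · intro y hy
    rw [hu.shearDensity_shear, hu.fderivWithin_shear hy, hu.abs_det]

end IsShearPerturbation

/-! ### Jensen-Shannon divergence against L¹ distance. -/

/-- The Hellinger bound `klFun r ≥ (√r - 1)²` comes from `log x ≤ x - 1` at `x = 1 / √r`; then `(√r
+ 1)² ≤ 6` for `r ≤ 2`. -/
theorem sq_sub_one_div_six_le_klFun {r : ℝ} (h0 : 0 ≤ r) (h2 : r ≤ 2) :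
    (r - 1) ^ 2 / 6 ≤ InformationTheory.klFun r := by
  rcases h0.eq_or_lt with rfl | hr
  · rw [InformationTheory.klFun_zero]; norm_num
  · set s := Real.sqrt r with hs
    have hs0 : 0 < s := Real.sqrt_pos.2 hr
    have hsq : s ^ 2 = r := Real.sq_sqrt hr.le
    have hlog : Real.log r = -(2 * Real.log s⁻¹) := by
      rw [Real.log_inv, ← hsq, Real.log_pow]; push_cast; ring
    have h1 : Real.log s⁻¹ ≤ s⁻¹ - 1 := Real.log_le_sub_one_of_pos (by positivity)
    have h3 : (s - 1) ^ 2 ≤ InformationTheory.klFun r := by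
      rw [InformationTheory.klFun_apply, hlog, ← hsq]
      have : s ^ 2 * Real.log s⁻¹ ≤ s ^ 2 * (s⁻¹ - 1) := by gcongr
      have e : s ^ 2 * (s⁻¹ - 1) = s - s ^ 2 := by field_simp
      nlinarith
    refine le_trans ?_ h3
    rw [← hsq]
    have h4 : (s + 1) ^ 2 ≤ 6 := by
      have : s ≤ 1.44 := by nlinarith
      nlinarith
    have : (s ^ 2 - 1) ^ 2 = (s - 1) ^ 2 * (s + 1) ^ 2 := by ring
    rw [this]
    nlinarith [sq_nonneg (s - 1)]

theorem IsCubeDensity.lintegral_eq_one {d : ℕ} {p : EuclideanSpace ℝ (Fin d) → ℝ}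
    (hp : IsCubeDensity p) : ∫⁻ x in unitCube d, ENNReal.ofReal (p x) = 1 := by
  have hint : IntegrableOn p (unitCube d) := by
    by_contra h
    have := hp.2
    rw [integral_undef h] at this
    exact zero_ne_one this
  rw [← ofReal_integral_eq_lintegral_ofReal hint
    ((ae_restrict_iff' (measurableSet_unitCube d)).2 (ae_of_all _ hp.1)), hp.2, ENNReal.ofReal_one]

theorem IsCubeDensity.isProbabilityMeasure {d : ℕ} {p : EuclideanSpace ℝ (Fin d) → ℝ}
    (hp : IsCubeDensity p) : IsProbabilityMeasure (densityMeasure p) := by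
  constructor
  rw [densityMeasure, withDensity_apply _ MeasurableSet.univ, Measure.restrict_univ]
  exact hp.lintegral_eq_one

theorem ae_densityMeasure_mem {d : ℕ} (p : EuclideanSpace ℝ (Fin d) → ℝ) :
    ∀ᵐ x ∂(densityMeasure p), x ∈ unitCube d :=
  (withDensity_absolutelyContinuous _ _).ae_le (ae_restrict_mem (measurableSet_unitCube d))

theorem IsCubeDensity.half_add {d : ℕ} {p q : EuclideanSpace ℝ (Fin d) → ℝ}
    (hp : IsCubeDensity p) (hq : IsCubeDensity q) :
    IsCubeDensity fun x => (p x + q x) / 2 := by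
  have hint : ∀ {r : EuclideanSpace ℝ (Fin d) → ℝ}, IsCubeDensity r →
      IntegrableOn r (unitCube d) := by
    intro r hr
    by_contra h
    have := hr.2
    rw [integral_undef h] at this
    exact zero_ne_one this
  refine ⟨fun x hx => by linarith [hp.1 x hx, hq.1 x hx], ?_⟩
  rw [integral_div, integral_add (hint hp) (hint hq), hp.2, hq.2]
  norm_num

/-- If `q` is positive, the measure with density `p` has density `p / q` relative to that with
density `q`. -/
theorem densityMeasure_eq_withDensity {d : ℕ} {p q : EuclideanSpace ℝ (Fin d) → ℝ}
    (hp : Measurable p) (hq : Measurable q) (hq0 : ∀ x ∈ unitCube d, 0 < q x) :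
    densityMeasure p = (densityMeasure q).withDensity fun x => ENNReal.ofReal (p x / q x) := by
  have hr : Measurable fun x => ENNReal.ofReal (p x / q x) := (hp.div hq).ennreal_ofReal
  rw [densityMeasure, densityMeasure, ← withDensity_mul _ hq.ennreal_ofReal hr]
  refine withDensity_congr_ae ((ae_restrict_iff' (measurableSet_unitCube d)).2
    (ae_of_all _ fun x hx => ?_))
  have := hq0 x hx
  simp only [Pi.mul_apply]
  rw [← ENNReal.ofReal_mul this.le, mul_div_cancel₀ _ this.ne']

theorem lintegral_densityMeasure {d : ℕ} {q : EuclideanSpace ℝ (Fin d) → ℝ} (hq : Measurable q)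
    {f : EuclideanSpace ℝ (Fin d) → ℝ≥0∞} (hf : Measurable f) :
    ∫⁻ x, f x ∂(densityMeasure q) = ∫⁻ x in unitCube d, ENNReal.ofReal (q x) * f x := by
  rw [densityMeasure, lintegral_withDensity_eq_lintegral_mul _ hq.ennreal_ofReal hf]
  rfl

/-- With `m = (p + q) / 2` and `r = q / m ≤ 2` one has `|p - q| = 2 m |r - 1|`, and `2 t |r - 1| ≤
(r - 1)² + t²`. The left side is linear in the L¹ distance; optimising `t` later recovers the
quadratic bound. -/
theorem ofReal_mul_lintegral_abs_sub_le_klDensity {d : ℕ} {p q : EuclideanSpace ℝ (Fin d) → ℝ}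
    (hpm : Measurable p) (hqm : Measurable q) (hp : IsCubeDensity p) (hq : IsCubeDensity q)
    (hq0 : ∀ x ∈ unitCube d, 0 < q x) {t : ℝ} (ht : 0 ≤ t) :
    ENNReal.ofReal (t / 6) * ∫⁻ x in unitCube d, ENNReal.ofReal |p x - q x| ≤
      klDensity q (fun x => (p x + q x) / 2) + ENNReal.ofReal (t ^ 2 / 6) := by
  set m : EuclideanSpace ℝ (Fin d) → ℝ := fun x => (p x + q x) / 2 with hm
  have hmm : Measurable m := (hpm.add hqm).div_const 2
  have hmd : IsCubeDensity m := hp.half_add hq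
  have hm0 : ∀ x ∈ unitCube d, 0 < m x := fun x hx => by
    have := hp.1 x hx; have := hq0 x hx; simp only [hm]; linarith
  have := hmd.isProbabilityMeasure
  have := hq.isProbabilityMeasure
  have hrm : Measurable fun x => ENNReal.ofReal (q x / m x) := (hqm.div hmm).ennreal_ofReal
  have hw := densityMeasure_eq_withDensity hqm hmm hm0
  have hac : densityMeasure q ≪ densityMeasure m := by
    rw [hw]; exact withDensity_absolutelyContinuous _ _
  have hrn : (densityMeasure q).rnDeriv (densityMeasure m) =ᵐ[densityMeasure m]
      fun x => ENNReal.ofReal (q x / m x) := by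
    conv_lhs => rw [hw]
    exact Measure.rnDeriv_withDensity _ hrm
  rw [klDensity, InformationTheory.klDiv_eq_lintegral_klFun_of_ac hac]
  have e1 : ∫⁻ x in unitCube d, ENNReal.ofReal |p x - q x| =
      ∫⁻ x, ENNReal.ofReal (|p x - q x| / m x) ∂(densityMeasure m) := by
    rw [lintegral_densityMeasure hmm (by fun_prop)]
    refine setLIntegral_congr_fun (measurableSet_unitCube d) fun x hx => ?_
    rw [← ENNReal.ofReal_mul (hm0 x hx).le, mul_div_cancel₀ _ (hm0 x hx).ne']
  have e2 : ENNReal.ofReal (t ^ 2 / 6) =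
      ∫⁻ _x, ENNReal.ofReal (t ^ 2 / 6) ∂(densityMeasure m) := by simp
  rw [e1, e2, ← lintegral_const_mul _ (by fun_prop), ← lintegral_add_right _ measurable_const]
  refine lintegral_mono_ae ?_
  filter_upwards [hrn, ae_densityMeasure_mem m] with x hx hxc
  have hm0x := hm0 x hxc
  have hq0x := hq0 x hxc
  have hp0x := hp.1 x hxc
  have hmx : m x = (p x + q x) / 2 := rfl
  have hr0 : 0 ≤ q x / m x := by positivity
  have hr2 : q x / m x ≤ 2 := by rw [div_le_iff₀ hm0x]; linarith
  rw [hx, ENNReal.toReal_ofReal hr0, ← ENNReal.ofReal_mul (by positivity),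
    ← ENNReal.ofReal_add (InformationTheory.klFun_nonneg hr0) (by positivity)]
  refine ENNReal.ofReal_le_ofReal ?_
  have h1 := sq_sub_one_div_six_le_klFun hr0 hr2
  have h2 : |p x - q x| / m x = 2 * |q x / m x - 1| := by
    have : q x / m x - 1 = (q x - p x) / (2 * m x) := by
      field_simp; rw [hmx]; ring
    rw [this, abs_div, abs_sub_comm, abs_of_pos (by positivity : 0 < 2 * m x)]
    field_simp
  rw [h2]
  have h3 : (q x / m x - 1) ^ 2 = |q x / m x - 1| ^ 2 := (sq_abs _).symm
  rw [h3] at h1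
  nlinarith [sq_nonneg (|q x / m x - 1| - t)]

theorem ofReal_mul_lintegral_abs_sub_le_jsDensity {d : ℕ} {p q : EuclideanSpace ℝ (Fin d) → ℝ}
    (hpm : Measurable p) (hqm : Measurable q) (hp : IsCubeDensity p) (hq : IsCubeDensity q)
    (hq0 : ∀ x ∈ unitCube d, 0 < q x) {t : ℝ} (ht : 0 ≤ t) :
    ENNReal.ofReal (t / 12) * ∫⁻ x in unitCube d, ENNReal.ofReal |p x - q x| ≤
      jsDensity p q + ENNReal.ofReal (t ^ 2 / 12) := by
  have h := mul_le_mul_right (ofReal_mul_lintegral_abs_sub_le_klDensity hpm hqm hp hq hq0 ht) 2⁻¹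
  have e : ∀ a : ℝ, ENNReal.ofReal (a / 12) = 2⁻¹ * ENNReal.ofReal (a / 6) := by
    intro a
    rw [show a / 12 = 2⁻¹ * (a / 6) by ring, ENNReal.ofReal_mul (by norm_num),
      ENNReal.ofReal_inv_of_pos (by norm_num)]
    norm_num
  rw [e, e, mul_assoc]
  rw [mul_add] at h
  refine h.trans (add_le_add_left ?_ _)
  rw [jsDensity]
  exact le_add_self

/-! ### Two-point testing and Assouad's lemma. -/

theorem lintegral_pi_prod {Ω : Type*} [MeasurableSpace Ω] (μ : Measure Ω) [IsProbabilityMeasure μ]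
    {n : ℕ} {f : Fin n → Ω → ℝ≥0∞} (hf : ∀ k, Measurable (f k)) :
    ∫⁻ X, ∏ k, f k (X k) ∂(Measure.pi fun _ : Fin n => μ) = ∏ k, ∫⁻ x, f k x ∂μ := by
  have hind := ProbabilityTheory.iIndepFun_pi (μ := fun _ : Fin n => μ) (X := f)
    fun k => (hf k).aemeasurable
  rw [ProbabilityTheory.lintegral_prod_eq_prod_lintegral_of_indepFun Finset.univ
    (fun k (X : Fin n → Ω) => f k (X k)) hind fun k => (hf k).comp (measurable_pi_apply k)]
  refine Finset.prod_congr rfl fun k _ => ?_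
  exact (measurePreserving_eval (fun _ : Fin n => μ) k).lintegral_comp (hf k)

theorem pi_withDensity_eq {Ω : Type*} [MeasurableSpace Ω] (μ : Measure Ω) [IsProbabilityMeasure μ]
    {l : Ω → ℝ≥0∞} (hl : Measurable l) [IsProbabilityMeasure (μ.withDensity l)] (n : ℕ) :
    Measure.pi (fun _ : Fin n => μ.withDensity l) =
      (Measure.pi fun _ : Fin n => μ).withDensity fun X => ∏ k, l (X k) := by
  refine Measure.pi_eq (μ := fun _ : Fin n => μ.withDensity l) fun s hs => ?_
  rw [withDensity_apply _ (MeasurableSet.univ_pi hs),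
    ← lintegral_indicator (MeasurableSet.univ_pi hs)]
  have h1 : ∀ X : Fin n → Ω, (Set.univ.pi s).indicator (fun X => ∏ k, l (X k)) X =
      ∏ k, (s k).indicator l (X k) := by
    intro X
    by_cases h : X ∈ Set.univ.pi s
    · rw [indicator_of_mem h]
      exact Finset.prod_congr rfl fun k _ => (indicator_of_mem (h k (mem_univ k)) _).symm
    · rw [indicator_of_notMem h]
      simp only [mem_pi, mem_univ, true_implies, not_forall] at h
      obtain ⟨k, hk⟩ := h
      exact (Finset.prod_eq_zero (Finset.mem_univ k) (indicator_of_notMem hk _)).symm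
  simp_rw [h1]
  rw [lintegral_pi_prod μ fun k => hl.indicator (hs k)]
  refine Finset.prod_congr rfl fun k _ => ?_
  rw [lintegral_indicator (hs k), withDensity_apply _ (hs k)]

theorem le_min_one_add_sq_div_four (x : ℝ≥0∞) : x ≤ min 1 x + 4⁻¹ * x ^ 2 := by
  rcases eq_or_ne x ⊤ with rfl | hx
  · have : (4⁻¹ : ℝ≥0∞) * ⊤ ^ 2 = ⊤ := by
      rw [ENNReal.top_pow (by norm_num)]; exact ENNReal.mul_top (by simp)
    rw [this]; simp
  · rcases le_total x 1 with h | h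
    · rw [min_eq_right h]; exact le_self_add
    · rw [min_eq_left h]
      have h1 : x = ENNReal.ofReal x.toReal := (ENNReal.ofReal_toReal hx).symm
      have h4 : (4⁻¹ : ℝ≥0∞) = ENNReal.ofReal (1 / 4) := by
        rw [one_div, ENNReal.ofReal_inv_of_pos (by norm_num)]; norm_num
      rw [h4, h1, ← ENNReal.ofReal_pow (by positivity), ← ENNReal.ofReal_mul (by norm_num),
        ← ENNReal.ofReal_one, ← ENNReal.ofReal_add (by norm_num) (by positivity)]
      refine ENNReal.ofReal_le_ofReal ?_
      nlinarith [sq_nonneg (x.toReal / 2 - 1)]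

/-- Two hypotheses with bounded `χ²` divergence cannot both be identified with a small loss. -/
theorem half_le_lintegral_add_lintegral {Ω : Type*} [MeasurableSpace Ω] (P : Measure Ω)
    [IsProbabilityMeasure P] {L : Ω → ℝ≥0∞} (hL : Measurable L)
    [IsProbabilityMeasure (P.withDensity L)] (hL2 : ∫⁻ x, L x ^ 2 ∂P ≤ 2) {a b : Ω → ℝ≥0∞}
    (ha : Measurable a) (hb : Measurable b) {Δ : ℝ≥0∞} (hab : ∀ x, Δ ≤ a x + b x) :
    2⁻¹ * Δ ≤ ∫⁻ x, a x ∂P + ∫⁻ x, b x ∂(P.withDensity L) := by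
  have hL1 : ∫⁻ x, L x ∂P = 1 := by
    have h := measure_univ (μ := P.withDensity L)
    rwa [withDensity_apply _ MeasurableSet.univ, Measure.restrict_univ] at h
  -- The overlap `∫ min 1 L` is at least `∫ L - (1/4) ∫ L² ≥ 1 - 2/4`.
  have hmin : 2⁻¹ ≤ ∫⁻ x, min 1 (L x) ∂P := by
    have h1 : 1 ≤ ∫⁻ x, min 1 (L x) ∂P + 4⁻¹ * ∫⁻ x, L x ^ 2 ∂P := by
      rw [← lintegral_const_mul _ (hL.pow_const 2),
        ← lintegral_add_left (measurable_const.min hL)]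
      exact hL1.symm.le.trans (lintegral_mono fun x => le_min_one_add_sq_div_four (L x))
    have h2 : (4⁻¹ : ℝ≥0∞) * ∫⁻ x, L x ^ 2 ∂P ≤ 2⁻¹ := by
      calc _ ≤ (4⁻¹ : ℝ≥0∞) * 2 := by gcongr
        _ = 2⁻¹ := by
          rw [show (4 : ℝ≥0∞) = 2 * 2 by norm_num, ENNReal.mul_inv (by simp) (by simp), mul_assoc,
            ENNReal.inv_mul_cancel (by simp) (by simp), mul_one]
    have h3 : (2⁻¹ : ℝ≥0∞) + 2⁻¹ ≤ ∫⁻ x, min 1 (L x) ∂P + 2⁻¹ := by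
      rw [ENNReal.inv_two_add_inv_two]
      exact h1.trans (by gcongr)
    exact (ENNReal.add_le_add_iff_right (by simp)).1 h3
  rw [lintegral_withDensity_eq_lintegral_mul _ hL hb, ← lintegral_add_left ha]
  calc 2⁻¹ * Δ ≤ (∫⁻ x, min 1 (L x) ∂P) * Δ := by gcongr
    _ = ∫⁻ x, min 1 (L x) * Δ ∂P := (lintegral_mul_const _ (measurable_const.min hL)).symm
    _ ≤ _ := by
        refine lintegral_mono fun x => ?_
        calc min 1 (L x) * Δ ≤ min 1 (L x) * (a x + b x) := by gcongr; exact hab x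
          _ = min 1 (L x) * a x + min 1 (L x) * b x := mul_add _ _ _
          _ ≤ 1 * a x + L x * b x := by
              gcongr
              · exact min_le_left _ _
              · exact min_le_right _ _
          _ = _ := by rw [one_mul]; rfl

/-- The second moment of the likelihood ratio is multiplicative over independent observations, and
`(1 + χ)^n ≤ exp (nχ) ≤ exp (1/2) ≤ 2`. -/
theorem half_le_lintegral_add_lintegral_pi {Ω : Type*} [MeasurableSpace Ω] (μ ν : Measure Ω)
    [IsProbabilityMeasure μ] [IsProbabilityMeasure ν] {l : Ω → ℝ≥0∞} (hl : Measurable l)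
    (hν : ν = μ.withDensity l) {n : ℕ} {χ : ℝ} (hχ0 : 0 ≤ χ) (hχ : n * χ ≤ 1 / 2)
    (hl2 : ∫⁻ x, l x ^ 2 ∂μ ≤ ENNReal.ofReal (1 + χ)) {a b : (Fin n → Ω) → ℝ≥0∞}
    (ha : Measurable a) (hb : Measurable b) {Δ : ℝ≥0∞} (hab : ∀ x, Δ ≤ a x + b x) :
    2⁻¹ * Δ ≤ ∫⁻ x, a x ∂(Measure.pi fun _ : Fin n => μ) +
      ∫⁻ x, b x ∂(Measure.pi fun _ : Fin n => ν) := by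
  subst hν
  have hpi := pi_withDensity_eq μ hl n
  have hprob : IsProbabilityMeasure ((Measure.pi fun _ : Fin n => μ).withDensity
      fun X => ∏ k, l (X k)) := by rw [← hpi]; infer_instance
  rw [hpi]
  refine half_le_lintegral_add_lintegral _ (by fun_prop) ?_ ha hb hab
  simp_rw [← Finset.prod_pow]
  rw [lintegral_pi_prod μ (f := fun _ x => l x ^ 2) fun k => hl.pow_const 2, Finset.prod_const,
    Finset.card_univ, Fintype.card_fin]
  calc (∫⁻ x, l x ^ 2 ∂μ) ^ n ≤ ENNReal.ofReal (1 + χ) ^ n := by gcongr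
    _ = ENNReal.ofReal ((1 + χ) ^ n) := (ENNReal.ofReal_pow (by linarith) n).symm
    _ ≤ ENNReal.ofReal 2 := by
        refine ENNReal.ofReal_le_ofReal ?_
        calc (1 + χ) ^ n ≤ (Real.exp χ) ^ n := by
              gcongr; rw [add_comm]; exact Real.add_one_le_exp χ
          _ = Real.exp (n * χ) := (Real.exp_nat_mul χ n).symm
          _ ≤ Real.exp (1 / 2) := Real.exp_le_exp.2 hχ
          _ ≤ 2 := by
              have h1 : Real.exp (1 / 2) ^ 2 = Real.exp 1 := by
                rw [← Real.exp_nat_mul]; norm_num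
              have h2 := Real.exp_one_lt_d9
              have h3 := Real.exp_pos (1 / 2)
              nlinarith
    _ = 2 := by norm_num

/-- Assouad's lemma: averaging two-point bounds over the hypercube. -/
theorem card_mul_le_sum_hypercube {J : Type*} [Fintype J] [DecidableEq J]
    (f : J → (J → Bool) → ℝ≥0∞) {κ : ℝ≥0∞}
    (hf : ∀ j s, κ ≤ f j s + f j (Function.update s j (!s j))) :
    (2 : ℝ≥0∞) ^ Fintype.card J * (Fintype.card J * κ) ≤ 2 * ∑ s, ∑ j, f j s := by
  -- Flipping one bit is an involution of the hypercube, so summing the hypothesis over all vertices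
  -- counts each value twice.
  have hflip : ∀ j : J, Function.Involutive fun s : J → Bool => Function.update s j (!s j) := by
    intro j s
    simp
  have hj : ∀ j, (2 : ℝ≥0∞) ^ Fintype.card J * κ ≤ 2 * ∑ s, f j s := by
    intro j
    have h1 : ∑ s, f j (Function.update s j (!s j)) = ∑ s, f j s :=
      Equiv.sum_comp (hflip j).toPerm (f j)
    calc (2 : ℝ≥0∞) ^ Fintype.card J * κ = ∑ _s : J → Bool, κ := by simp
      _ ≤ ∑ s, (f j s + f j (Function.update s j (!s j))) := Finset.sum_le_sum fun s _ => hf j s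
      _ = 2 * ∑ s, f j s := by rw [Finset.sum_add_distrib, h1, two_mul]
  calc _ = ∑ _j : J, (2 : ℝ≥0∞) ^ Fintype.card J * κ := by simp; ring
    _ ≤ ∑ j, 2 * ∑ s, f j s := Finset.sum_le_sum fun j _ => hj j
    _ = _ := by rw [← Finset.mul_sum, Finset.sum_comm]

theorem mul_card_mul_le_of_hypercube {J : Type*} [Fintype J] [DecidableEq J]
    (f : J → (J → Bool) → ℝ≥0∞) {κ R t : ℝ≥0∞}
    (hf : ∀ j s, κ ≤ f j s + f j (Function.update s j (!s j)))
    (hR : ∀ s, t * ∑ j, f j s ≤ R) : t * (Fintype.card J * κ) ≤ 2 * R := by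
  have h1 := card_mul_le_sum_hypercube f hf
  have h2 : t * ∑ s, ∑ j, f j s ≤ 2 ^ Fintype.card J * R := by
    rw [Finset.mul_sum]
    calc _ ≤ ∑ _s : J → Bool, R := Finset.sum_le_sum fun s _ => hR s
      _ = _ := by simp
  have h3 : (2 : ℝ≥0∞) ^ Fintype.card J * (t * (Fintype.card J * κ)) ≤
      2 ^ Fintype.card J * (2 * R) := by
    calc _ = t * (2 ^ Fintype.card J * (Fintype.card J * κ)) := by ring
      _ ≤ t * (2 * ∑ s, ∑ j, f j s) := by gcongr
      _ = 2 * (t * ∑ s, ∑ j, f j s) := by ring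
      _ ≤ 2 * (2 ^ Fintype.card J * R) := by gcongr
      _ = _ := by ring
  exact (ENNReal.mul_le_mul_iff_right (by simp) (by simp)).1 h3

/-! ### The χ² divergence between neighbouring hypotheses. -/

namespace IsShearPerturbation

variable {d N : ℕ} {i₀ : Fin d} {τ : ℝ} {u v : EuclideanSpace ℝ (Fin d) → ℝ}

theorem integrableOn_shearDensity (hu : IsShearPerturbation N i₀ τ u) :
    IntegrableOn (shearDensity i₀ u) (unitCube d) := by
  by_contra h
  have := hu.setIntegral_shearDensity
  rw [integral_undef h] at this
  exact zero_ne_one this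

theorem fderiv_sub_of_eq_add_trigWave (hu : IsShearPerturbation N i₀ τ u) {c : Fin d → ℝ} {a : ℝ}
    (hv : ∀ x, v x = u x + a * trigWave N i₀ c x) (x e : EuclideanSpace ℝ (Fin d)) :
    fderiv ℝ v x e - fderiv ℝ u x e = a * fderiv ℝ (trigWave N i₀ c) x e := by
  have hw := partialRieszFormula_trigWave hu.pos i₀ c
  have : v = fun x => u x + a * trigWave N i₀ c x := funext hv
  rw [this, fderiv_fun_add (hu.riesz.differentiable x) ((hw.const_mul a).differentiable x),
    fderiv_const_mul (hw.differentiable x)]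
  change fderiv ℝ u x e + a * fderiv ℝ (trigWave N i₀ c) x e - fderiv ℝ u x e = _
  ring

/-- The change of variables by the shear of `v` brings the integrand to the points where the
densities were compared. The constant is `144 = 4 * 36`, where `36 = 4² * (3/2) / (2/3)` collects
that comparison, the Jacobian and the lower bound of the density. -/
theorem setIntegral_sq_sub_div_le (hu : IsShearPerturbation N i₀ τ u)
    (hv : IsShearPerturbation N i₀ τ v) {c : Fin d → ℝ} {a : ℝ} (ha : |a| = τ)
    (hvu : ∀ x, v x = u x + a * trigWave N i₀ c x) :
    ∫ x in unitCube d, (shearDensity i₀ v x - shearDensity i₀ u x) ^ 2 / shearDensity i₀ u x ≤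
      144 * (4 * Real.pi * N * τ) ^ 2 * (1 / (N : ℝ)) ^ d := by
  have h := hv.setIntegral_image (measurableSet_unitCube d)
    (fun x => (shearDensity i₀ v x - shearDensity i₀ u x) ^ 2 / shearDensity i₀ u x)
  rw [hv.image_unitCube] at h
  rw [h]
  have hw := partialRieszFormula_trigWave hu.pos i₀ c
  have hwc := hw.contDiff.continuous
  have hcd := continuous_fderiv_single hw i₀
  calc _ ≤ ∫ x in unitCube d, 36 * τ ^ 2 * (4 * Real.pi * N * |trigWave N i₀ c x| +
        |fderiv ℝ (trigWave N i₀ c) x (EuclideanSpace.single i₀ 1)|) ^ 2 := by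
        refine integral_mono_of_nonneg (ae_of_all _ fun x => ?_)
          (Continuous.integrableOn_unitCube (by fun_prop)) (ae_of_all _ fun x => ?_)
        · have := hv.le_jacobian x
          have := (hu.shearDensity_pos (shear i₀ v x)).le
          have : 0 ≤ 1 + fderiv ℝ v x (EuclideanSpace.single i₀ 1) := by linarith
          simp only [Pi.zero_apply]
          positivity
        · dsimp only
          have h1 := hu.abs_shearDensity_sub_le hv x
          rw [hu.fderiv_sub_of_eq_add_trigWave hvu, hvu x, add_sub_cancel_left, abs_mul, abs_mul,
            ha] at h1
          set B := 4 * Real.pi * N * |trigWave N i₀ c x| +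
            |fderiv ℝ (trigWave N i₀ c) x (EuclideanSpace.single i₀ 1)|
          have hB : 0 ≤ B := by positivity
          have h1' : |shearDensity i₀ v (shear i₀ v x) - shearDensity i₀ u (shear i₀ v x)| ≤
              4 * (τ * B) := h1.trans_eq (by simp only [B]; ring)
          have h2 := sq_le_sq' (by linarith [abs_nonneg (shearDensity i₀ v (shear i₀ v x) -
            shearDensity i₀ u (shear i₀ v x)), neg_nonpos.2 ((abs_nonneg _).trans h1')]) h1'
          rw [sq_abs] at h2
          have h3 := hv.jacobian_le x
          have h3' := hv.le_jacobian x
          have h4 := (hu.shearDensity_bounds (shear i₀ v x)).1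
          calc _ ≤ 3 / 2 * ((4 * (τ * B)) ^ 2 / (2 / 3)) := by gcongr
            _ = 36 * τ ^ 2 * B ^ 2 := by ring
    _ = 36 * τ ^ 2 * ∫ x in unitCube d, (4 * Real.pi * N * |trigWave N i₀ c x| +
        |fderiv ℝ (trigWave N i₀ c) x (EuclideanSpace.single i₀ 1)|) ^ 2 :=
        integral_const_mul _ _
    _ ≤ 36 * τ ^ 2 * (4 * (4 * Real.pi * N) ^ 2 * (1 / (N : ℝ)) ^ d) := by
        gcongr
        exact setIntegral_sq_trigWave_le hu.pos i₀ c
    _ = _ := by ring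

theorem lintegral_sq_div_le (hu : IsShearPerturbation N i₀ τ u)
    (hv : IsShearPerturbation N i₀ τ v) {c : Fin d → ℝ} {a : ℝ} (ha : |a| = τ)
    (hvu : ∀ x, v x = u x + a * trigWave N i₀ c x) :
    ∫⁻ x, ENNReal.ofReal (shearDensity i₀ v x / shearDensity i₀ u x) ^ 2
      ∂(densityMeasure (shearDensity i₀ u)) ≤
      ENNReal.ofReal (1 + 144 * (4 * Real.pi * N * τ) ^ 2 * (1 / (N : ℝ)) ^ d) := by
  have hum := hu.measurable_shearDensity
  have hvm := hv.measurable_shearDensity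
  have hmeas : Measurable fun x => ENNReal.ofReal (shearDensity i₀ v x / shearDensity i₀ u x) ^ 2 :=
    (hvm.div hum).ennreal_ofReal.pow_const 2
  rw [lintegral_densityMeasure hum hmeas]
  set q := shearDensity i₀ v
  set p := shearDensity i₀ u
  -- The part `2q - p` integrates to `1`, which isolates the χ² divergence.
  have h1 : ∀ x, ENNReal.ofReal (p x) * ENNReal.ofReal (q x / p x) ^ 2 =
      ENNReal.ofReal (2 * q x - p x + (q x - p x) ^ 2 / p x) := by
    intro x
    have hp0 := hu.shearDensity_pos x
    have hq0 := hv.shearDensity_pos x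
    rw [← ENNReal.ofReal_pow (div_pos hq0 hp0).le, ← ENNReal.ofReal_mul hp0.le]
    congr 1
    have hp0' : p x ≠ 0 := hp0.ne'
    field_simp
    ring
  simp_rw [h1]
  have hint : IntegrableOn (fun x => (q x - p x) ^ 2 / p x) (unitCube d) := by
    refine Measure.integrableOn_of_bounded (M := 6) (by simp [volume_unitCube])
      (((hvm.sub hum).pow_const 2).div hum).aestronglyMeasurable (ae_of_all _ fun x => ?_)
    have hp := hu.shearDensity_bounds x
    have hq := hv.shearDensity_bounds x
    have hp1 : 2 / 3 ≤ p x := hp.1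
    have hp2 : p x ≤ 2 := hp.2
    have hq1 : 2 / 3 ≤ q x := hq.1
    have hq2 : q x ≤ 2 := hq.2
    rw [Real.norm_of_nonneg (by positivity), div_le_iff₀ (by linarith)]
    nlinarith
  have hint2 : IntegrableOn (fun x => 2 * q x - p x) (unitCube d) :=
    (hv.integrableOn_shearDensity.const_mul 2).sub hu.integrableOn_shearDensity
  have hsum : IntegrableOn (fun x => 2 * q x - p x + (q x - p x) ^ 2 / p x) (unitCube d) :=
    hint2.add hint
  rw [← ofReal_integral_eq_lintegral_ofReal hsum]
  · refine ENNReal.ofReal_le_ofReal ?_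
    rw [integral_add hint2 hint, integral_sub (hv.integrableOn_shearDensity.const_mul 2)
      hu.integrableOn_shearDensity, integral_const_mul, hv.setIntegral_shearDensity,
      hu.setIntegral_shearDensity]
    have := hu.setIntegral_sq_sub_div_le hv ha hvu
    linarith
  · refine ae_of_all _ fun x => ?_
    have hp0 := hu.shearDensity_pos x
    have hp0' : p x ≠ 0 := hp0.ne'
    have e : 2 * q x - p x + (q x - p x) ^ 2 / p x = q x ^ 2 / p x := by
      field_simp
      ring
    change 0 ≤ 2 * q x - p x + (q x - p x) ^ 2 / p x
    rw [e]
    exact div_nonneg (sq_nonneg _) hp0.le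

end IsShearPerturbation

/-! ### L¹ separation on disjoint cells. -/

/-- The open cell of side `1 / N` around `c`. -/
def gridCell {d : ℕ} (N : ℕ) (c : Fin d → ℝ) : Set (EuclideanSpace ℝ (Fin d)) :=
  {x | ∀ i, |x i - c i| < 1 / (2 * N)}

/-- The part of the cell around `c` where the wave concentrated around `c` is steep. -/
def steepBox {d : ℕ} (N : ℕ) (c : Fin d → ℝ) : Set (EuclideanSpace ℝ (Fin d)) :=
  {x | ∀ i, x i ∈ Icc (c i + 1 / (8 * N)) (c i + 1 / (6 * N))}

theorem steepBox_eq_preimage {d : ℕ} (N : ℕ) (c : Fin d → ℝ) :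
    steepBox N c = WithLp.ofLp ⁻¹'
      (Set.univ.pi fun i => Icc (c i + 1 / (8 * N : ℝ)) (c i + 1 / (6 * N))) := by
  ext; simp only [steepBox, mem_ofPred_eq, mem_preimage, mem_pi, mem_univ, forall_const]

theorem measurableSet_steepBox {d : ℕ} (N : ℕ) (c : Fin d → ℝ) : MeasurableSet (steepBox N c) := by
  rw [steepBox_eq_preimage]
  exact (WithLp.measurable_ofLp 2 (Fin d → ℝ)) (MeasurableSet.univ_pi fun _ => measurableSet_Icc)

theorem volume_steepBox {d N : ℕ} (hN : 0 < N) (c : Fin d → ℝ) :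
    volume (steepBox N c) = ENNReal.ofReal ((1 / (24 * N : ℝ)) ^ d) := by
  rw [steepBox_eq_preimage]
  have h := (EuclideanSpace.volume_preserving_symm_measurableEquiv_toLp
    (Fin d)).measure_preimage_equiv
      (Set.univ.pi fun i => Icc (c i + 1 / (8 * N : ℝ)) (c i + 1 / (6 * N)))
  refine Eq.trans h ?_
  rw [volume_pi_pi]
  have hN0 : (N : ℝ) ≠ 0 := by positivity
  have : ∀ i, c i + 1 / (6 * N : ℝ) - (c i + 1 / (8 * N)) = 1 / (24 * N) := by
    intro i; rw [add_sub_add_left_eq_sub]; field_simp; norm_num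
  simp_rw [Real.volume_Icc, this]
  rw [Finset.prod_const, Finset.card_univ, Fintype.card_fin, ENNReal.ofReal_pow (by positivity)]

theorem measurableSet_gridCell {d : ℕ} (N : ℕ) (c : Fin d → ℝ) : MeasurableSet (gridCell N c) := by
  have : gridCell N c = ⋂ i, {x | |x i - c i| < 1 / (2 * N)} := by ext; simp [gridCell]
  rw [this]
  refine MeasurableSet.iInter fun i => measurableSet_lt ?_ measurable_const
  have : Continuous fun x : EuclideanSpace ℝ (Fin d) => |x i - c i| :=
    ((EuclideanSpace.proj (𝕜 := ℝ) i).continuous.sub continuous_const).abs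
  exact this.measurable

theorem gridCenter_mem {d M : ℕ} (hM : 0 < M) (j : Fin d → Fin M) (i : Fin d) :
    1 / 8 ≤ gridCenter M j i ∧ gridCenter M j i + 1 / (8 * M : ℕ) ≤ 1 / 4 := by
  have hM0 : (0 : ℝ) < M := by exact_mod_cast hM
  have h1 : ((j i : ℕ) : ℝ) + 1 ≤ M := by exact_mod_cast (j i).2
  have h0 : (0 : ℝ) ≤ ((j i : ℕ) : ℝ) := by positivity
  rw [gridCenter]
  push_cast
  constructor
  · rw [div_le_div_iff₀ (by norm_num) (by positivity)]; nlinarith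
  · rw [← add_div, div_le_div_iff₀ (by positivity) (by norm_num)]; nlinarith

theorem gridCell_subset {d M : ℕ} (hM : 0 < M) (j : Fin d → Fin M) :
    gridCell (8 * M) (gridCenter M j) ⊆ unitCube d := by
  intro x hx i
  have h1 := abs_lt.1 (hx i)
  have h2 := gridCenter_mem hM j i
  have hM0 : (1 : ℝ) ≤ M := by exact_mod_cast hM
  have h3 : 1 / (2 * (8 * M : ℕ) : ℝ) ≤ 1 / 16 := by
    push_cast
    exact one_div_le_one_div_of_le (by norm_num) (by linarith)
  have h4 : (0 : ℝ) ≤ 1 / (8 * M : ℕ) := by positivity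
  constructor <;> linarith [h1.1, h1.2, h2.1, h2.2]

theorem pairwise_disjoint_gridCell {d M : ℕ} (hM : 0 < M) :
    Pairwise (Function.onFun Disjoint fun j : Fin d → Fin M =>
      gridCell (8 * M) (gridCenter M j)) := by
  intro j k hjk
  rw [Function.onFun, Set.disjoint_left]
  intro x hx hx'
  refine hjk (funext fun i => Fin.ext ?_)
  have h1 := abs_lt.1 (hx i)
  have h2 := abs_lt.1 (hx' i)
  have hM0 : (0 : ℝ) < (8 * M : ℕ) := by positivity
  have e : 1 / (2 * (8 * M : ℕ) : ℝ) + 1 / (2 * (8 * M : ℕ) : ℝ) = 1 / (8 * M : ℕ) := by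
    field_simp; norm_num
  have h3 : gridCenter M j i - gridCenter M k i < 1 / (8 * M : ℕ) := by linarith
  have h4 : gridCenter M k i - gridCenter M j i < 1 / (8 * M : ℕ) := by linarith
  rw [gridCenter, gridCenter, ← sub_div, div_lt_div_iff_of_pos_right hM0] at h3 h4
  have h5 : ((j i : ℕ) : ℝ) < (k i : ℕ) + 1 := by linarith
  have h6 : ((k i : ℕ) : ℝ) < (j i : ℕ) + 1 := by linarith
  have h7 : (j i : ℕ) < (k i : ℕ) + 1 := by exact_mod_cast h5
  have h8 : (k i : ℕ) < (j i : ℕ) + 1 := by exact_mod_cast h6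
  omega

namespace IsShearPerturbation

variable {d N : ℕ} {i₀ : Fin d} {τ : ℝ} {u v : EuclideanSpace ℝ (Fin d) → ℝ}

/-- The displacement is at most `τ ≤ 1 / (24N)`, and `1/6 + 1/24 < 1/2`. -/
theorem image_steepBox_subset (hv : IsShearPerturbation N i₀ τ v) (c : Fin d → ℝ) :
    shear i₀ v '' steepBox N c ⊆ gridCell N c := by
  rintro _ ⟨x, hx, rfl⟩ i
  have hN : (0 : ℝ) < N := by exact_mod_cast hv.pos
  have hτ : τ ≤ 1 / (8 * 3 * N) := by
    rw [le_div_iff₀ (by positivity)]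
    have h := hv.small
    have h0 := hv.tau_nonneg
    have := mul_le_mul_of_nonneg_right Real.pi_gt_three.le (by positivity : 0 ≤ (N : ℝ) * τ)
    linarith
  have h1 := abs_le.1 (hv.bound x)
  have h2 := hx i
  have e : 1 / (2 * N : ℝ) = 12 * (1 / (8 * 3 * N)) := by field_simp; norm_num
  have e6 : 1 / (6 * N : ℝ) = 4 * (1 / (8 * 3 * N)) := by field_simp; norm_num
  have e8 : 1 / (8 * N : ℝ) = 3 * (1 / (8 * 3 * N)) := by field_simp
  have hz : 0 < 1 / (8 * 3 * N : ℝ) := by positivity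
  rw [shear_apply, e, abs_lt]
  rw [e6, e8] at h2
  obtain ⟨h3, h4⟩ := h2
  split_ifs <;> constructor <;> linarith

/-- On the steep box the slope of the wave dominates the second-order shift error, which `hρ` makes
at most half as large. The box is carried into the cell by the shear of `v`, at the cost of a
Jacobian of at least `1 / 2`. -/
theorem le_setLIntegral_gridCell (hu : IsShearPerturbation N i₀ τ u)
    (hv : IsShearPerturbation N i₀ τ v) {c : Fin d → ℝ} {a : ℝ} (ha : |a| = τ)
    (hvu : ∀ x, v x = u x + a * trigWave N i₀ c x) (hN : 101 ≤ N)
    (hc : 1 / 8 ≤ c i₀ ∧ c i₀ + 1 / N ≤ 1 / 4)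
    (hρ : 2 * (4 * Real.pi * N * τ) ≤ (1 / 2) ^ d / 416) :
    ENNReal.ofReal (4 * Real.pi * N * τ * (1 / 2) ^ d / 4000 * (1 / (24 * N : ℝ)) ^ d) ≤
      ∫⁻ x in gridCell N c, ENNReal.ofReal |shearDensity i₀ v x - shearDensity i₀ u x| := by
  have hτ0 := hu.tau_nonneg
  have hN0 : (0 : ℝ) < N := by exact_mod_cast hu.pos
  set ρ := 4 * Real.pi * N * τ with hρdef
  have hρ0 : 0 ≤ ρ := by positivity
  have hpt : ∀ x ∈ steepBox N c, ENNReal.ofReal (ρ * (1 / 2) ^ d / 4000) ≤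
      ENNReal.ofReal (1 + fderiv ℝ v x (EuclideanSpace.single i₀ 1)) *
        ENNReal.ofReal |shearDensity i₀ v (shear i₀ v x) - shearDensity i₀ u (shear i₀ v x)| := by
    intro x hx
    have h1 := hu.le_abs_shearDensity_sub hv x
    rw [hu.fderiv_sub_of_eq_add_trigWave hvu, hvu x, add_sub_cancel_left, abs_mul, abs_mul, ha,
      ← hρdef] at h1
    have h2 := abs_fderiv_trigWave_ge hN i₀ c (x := x)
      (fun i => ⟨by linarith [(hx i).1], by linarith [(hx i).2]⟩)
      ⟨by have : 0 ≤ 1 / (8 * N : ℝ) := by positivity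
          linarith [(hx i₀).1], by
          have : 1 / (6 * N : ℝ) ≤ 1 / N := by
            apply one_div_le_one_div_of_le hN0; linarith
          linarith [(hx i₀).2]⟩
    have h3 := abs_trigWave_le_one hu.pos i₀ c x
    have h4 := hv.le_jacobian x
    rw [← ENNReal.ofReal_mul (by linarith)]
    refine ENNReal.ofReal_le_ofReal ?_
    -- Here `4π < 13`, and `208 = 13 * 16`. Subtracting the shift error leaves `1/208 - 1/416 =
    -- 1/416`, and a quarter of it exceeds `1/2000`.
    have h5 : ρ / 13 ≤ N * τ := by
      have := mul_le_mul_of_nonneg_right Real.pi_lt_d2.le (by positivity : 0 ≤ (N : ℝ) * τ)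
      rw [hρdef]; linarith
    have h6 : ρ / 208 * (1 / 2) ^ d ≤
        τ * |fderiv ℝ (trigWave N i₀ c) x (EuclideanSpace.single i₀ 1)| := by
      calc _ = ρ / 13 * (1 / 16 * (1 / 2) ^ d) := by ring
        _ ≤ N * τ * (1 / 16 * (1 / 2) ^ d) := by gcongr
        _ = τ * (N / 16 * (1 / 2) ^ d) := by ring
        _ ≤ _ := by gcongr
    have h7 : 2 * ρ * (4 * Real.pi * N * (τ * |trigWave N i₀ c x|)) ≤ (1 / 2) ^ d / 416 * ρ := by
      calc _ = 2 * ρ * ρ * |trigWave N i₀ c x| := by rw [hρdef]; ring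
        _ ≤ 2 * ρ * ρ * 1 := by gcongr
        _ ≤ _ := by rw [mul_one]; gcongr
    have h8 : ρ * (1 / 2) ^ d / 2000 ≤
        |shearDensity i₀ v (shear i₀ v x) - shearDensity i₀ u (shear i₀ v x)| := by
      refine le_trans ?_ h1
      have : 0 ≤ ρ * (1 / 2) ^ d := by positivity
      linarith
    calc ρ * (1 / 2) ^ d / 4000 = 1 / 2 * (ρ * (1 / 2) ^ d / 2000) := by ring
      _ ≤ _ := by gcongr
  calc _ = ENNReal.ofReal (ρ * (1 / 2) ^ d / 4000) * volume (steepBox N c) := by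
        rw [volume_steepBox hu.pos, ← ENNReal.ofReal_mul (by positivity)]
    _ = ∫⁻ _x in steepBox N c, ENNReal.ofReal (ρ * (1 / 2) ^ d / 4000) := by
        rw [setLIntegral_const]
    _ ≤ _ := setLIntegral_mono' (measurableSet_steepBox N c) hpt
    _ = ∫⁻ x in shear i₀ v '' steepBox N c,
          ENNReal.ofReal |shearDensity i₀ v x - shearDensity i₀ u x| :=
        (hv.setLIntegral_image (measurableSet_steepBox N c)
          fun x => ENNReal.ofReal |shearDensity i₀ v x - shearDensity i₀ u x|).symm
    _ ≤ _ := lintegral_mono_set (hv.image_steepBox_subset c)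

end IsShearPerturbation

/-! ### The hypercube of hypotheses and the choice of parameters. -/

/-- The sum of the waves on the grid that are selected by `s`, with amplitude `τ`. -/
noncomputable def waveSum {d M : ℕ} (i₀ : Fin d) (τ : ℝ) (s : (Fin d → Fin M) → Bool)
    (x : EuclideanSpace ℝ (Fin d)) : ℝ :=
  τ * ∑ j, (if s j then 1 else 0) * trigWave (8 * M) i₀ (gridCenter M j) x

theorem isShearPerturbation_waveSum {d M : ℕ} (hM : 0 < M) (i₀ : Fin d) {τ : ℝ} (hτ : 0 ≤ τ)
    (hsmall : 4 * Real.pi * (8 * M : ℕ) * τ ≤ 1 / 2) (s : (Fin d → Fin M) → Bool) :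
    IsShearPerturbation (8 * M) i₀ τ (waveSum i₀ τ s) where
  pos := by omega
  riesz := PartialRieszFormula.const_mul (PartialRieszFormula.sum fun j _ =>
    (partialRieszFormula_trigWave (by omega) i₀ (gridCenter M j)).const_mul _) τ
  bound x := by
    rw [waveSum, abs_mul, abs_of_nonneg hτ]
    refine mul_le_of_le_one_right hτ (abs_sum_trigWave_le_one hM i₀ _ (fun j => ?_) x)
    split_ifs <;> simp
  small := hsmall
  vanish x hx := by
    rw [waveSum]
    simp [trigWave_eq_zero _ i₀ _ hx]

theorem waveSum_update {d M : ℕ} (i₀ : Fin d) (τ : ℝ) (s : (Fin d → Fin M) → Bool)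
    (j : Fin d → Fin M) (x : EuclideanSpace ℝ (Fin d)) :
    waveSum i₀ τ (Function.update s j (!s j)) x =
      waveSum i₀ τ s x + (if s j then -τ else τ) * trigWave (8 * M) i₀ (gridCenter M j) x := by
  rw [waveSum, waveSum, ← Finset.add_sum_erase _ _ (Finset.mem_univ j),
    ← Finset.add_sum_erase (a := j) _ (fun k => (if s k then (1 : ℝ) else 0) *
      trigWave (8 * M) i₀ (gridCenter M k) x) (Finset.mem_univ j)]
  have h : ∑ k ∈ Finset.univ.erase j, (if Function.update s j (!s j) k then (1 : ℝ) else 0) *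
      trigWave (8 * M) i₀ (gridCenter M k) x = ∑ k ∈ Finset.univ.erase j,
      (if s k then (1 : ℝ) else 0) * trigWave (8 * M) i₀ (gridCenter M k) x :=
    Finset.sum_congr rfl fun k hk => by
      rw [Function.update_of_ne (Finset.ne_of_mem_erase hk)]
  rw [h, Function.update_self]
  cases s j <;> simp <;> ring

theorem measurable_setLIntegral_abs_sub {d n : ℕ}
    {phat : (Fin n → EuclideanSpace ℝ (Fin d)) → EuclideanSpace ℝ (Fin d) → ℝ}
    (hphat : Measurable (Function.uncurry phat)) {p : EuclideanSpace ℝ (Fin d) → ℝ}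
    (hp : Measurable p) (Q : Set (EuclideanSpace ℝ (Fin d))) :
    Measurable fun X => ∫⁻ x in Q, ENNReal.ofReal |phat X x - p x| := by
  have : Measurable fun z : (Fin n → EuclideanSpace ℝ (Fin d)) × EuclideanSpace ℝ (Fin d) =>
      ENNReal.ofReal |Function.uncurry phat z - p z.2| := by fun_prop
  exact this.lintegral_prod_right'

/-- The losses on disjoint cells add up to at most the L¹ distance on the cube, to which the
linearised divergence bound applies. Observations lie in the cube almost surely, which is all the
estimator's guarantee needs. -/
theorem ofReal_mul_sum_lintegral_le_jsRisk {d n : ℕ} {J : Type*} [Fintype J]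
    {phat : (Fin n → EuclideanSpace ℝ (Fin d)) → EuclideanSpace ℝ (Fin d) → ℝ}
    (hphat : IsDensityEstimator phat) {p : EuclideanSpace ℝ (Fin d) → ℝ} (hpm : Measurable p)
    (hp : IsCubeDensity p) (hp0 : ∀ x, 0 < p x) {Q : J → Set (EuclideanSpace ℝ (Fin d))}
    (hQ : ∀ j, MeasurableSet (Q j)) (hdisj : Pairwise (Function.onFun Disjoint Q))
    (hsub : ∀ j, Q j ⊆ unitCube d) {t : ℝ} (ht : 0 ≤ t) :
    ENNReal.ofReal (t / 12) * ∑ j, ∫⁻ X, (∫⁻ x in Q j, ENNReal.ofReal |phat X x - p x|)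
      ∂(Measure.pi fun _ : Fin n => densityMeasure p) ≤
        jsRisk phat p + ENNReal.ofReal (t ^ 2 / 12) := by
  have := hp.isProbabilityMeasure
  have hmeas := fun Q => measurable_setLIntegral_abs_sub hphat.measurable hpm Q
  set P := Measure.pi fun _ : Fin n => densityMeasure p with hP
  have hae : ∀ᵐ X ∂P, ∀ k, X k ∈ unitCube d := by
    rw [ae_all_iff]
    intro k
    exact (Measure.quasiMeasurePreserving_eval (fun _ : Fin n => densityMeasure p) k).ae
      (ae_densityMeasure_mem p)
  calc _ = ENNReal.ofReal (t / 12) * ∫⁻ X, ∑ j, (∫⁻ x in Q j, ENNReal.ofReal |phat X x - p x|) ∂P := by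
        rw [lintegral_finsetSum _ fun j _ => hmeas (Q j)]
    _ ≤ ENNReal.ofReal (t / 12) *
          ∫⁻ X, (∫⁻ x in unitCube d, ENNReal.ofReal |phat X x - p x|) ∂P := by
        gcongr with X
        rw [← tsum_fintype (L := SummationFilter.unconditional J), ← lintegral_iUnion hQ hdisj]
        exact lintegral_mono_set (iUnion_subset hsub)
    _ = ∫⁻ X, ENNReal.ofReal (t / 12) *
          (∫⁻ x in unitCube d, ENNReal.ofReal |phat X x - p x|) ∂P :=
        (lintegral_const_mul _ (hmeas _)).symm
    _ ≤ ∫⁻ X, (jsDensity (phat X) p + ENNReal.ofReal (t ^ 2 / 12)) ∂P := by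
        refine lintegral_mono_ae ?_
        filter_upwards [hae] with X hX
        exact ofReal_mul_lintegral_abs_sub_le_jsDensity
          (hphat.measurable.comp measurable_prodMk_left) hpm (hphat.isCubeDensity X hX) hp
          (fun x _ => hp0 x) ht
    _ = _ := by
        rw [lintegral_add_right _ measurable_const, lintegral_const, measure_univ, mul_one]
        rfl

theorem half_le_lintegral_add_lintegral_shear {d N n : ℕ} {i₀ : Fin d} {τ : ℝ}
    {u v : EuclideanSpace ℝ (Fin d) → ℝ} (hu : IsShearPerturbation N i₀ τ u)
    (hv : IsShearPerturbation N i₀ τ v) {c : Fin d → ℝ} {a : ℝ} (ha : |a| = τ)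
    (hvu : ∀ x, v x = u x + a * trigWave N i₀ c x) (hN : 101 ≤ N)
    (hc : 1 / 8 ≤ c i₀ ∧ c i₀ + 1 / N ≤ 1 / 4)
    (hρ : 2 * (4 * Real.pi * N * τ) ≤ (1 / 2) ^ d / 416)
    (hn : n * (144 * (4 * Real.pi * N * τ) ^ 2 * (1 / (N : ℝ)) ^ d) ≤ 1 / 2)
    {phat : (Fin n → EuclideanSpace ℝ (Fin d)) → EuclideanSpace ℝ (Fin d) → ℝ}
    (hphat : Measurable (Function.uncurry phat)) :
    2⁻¹ * ENNReal.ofReal (4 * Real.pi * N * τ * (1 / 2) ^ d / 4000 * (1 / (24 * N : ℝ)) ^ d) ≤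
      ∫⁻ X, (∫⁻ x in gridCell N c, ENNReal.ofReal |phat X x - shearDensity i₀ u x|)
        ∂(Measure.pi fun _ : Fin n => densityMeasure (shearDensity i₀ u)) +
      ∫⁻ X, (∫⁻ x in gridCell N c, ENNReal.ofReal |phat X x - shearDensity i₀ v x|)
        ∂(Measure.pi fun _ : Fin n => densityMeasure (shearDensity i₀ v)) := by
  have hum := hu.measurable_shearDensity
  have hvm := hv.measurable_shearDensity
  have := hu.isCubeDensity.isProbabilityMeasure
  have := hv.isCubeDensity.isProbabilityMeasure
  refine half_le_lintegral_add_lintegral_pi _ _ (hvm.div hum).ennreal_ofReal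
    (densityMeasure_eq_withDensity hvm hum fun x _ => hu.shearDensity_pos x) (by positivity) hn
    (hu.lintegral_sq_div_le hv ha hvu) (measurable_setLIntegral_abs_sub hphat hum _)
    (measurable_setLIntegral_abs_sub hphat hvm _) fun X => ?_
  refine (hu.le_setLIntegral_gridCell hv ha hvu hN hc hρ).trans ?_
  have hpX : Measurable (phat X) := hphat.comp measurable_prodMk_left
  rw [← lintegral_add_left (by fun_prop)]
  refine lintegral_mono fun x => ?_
  rw [← ENNReal.ofReal_add (abs_nonneg _) (abs_nonneg _)]
  refine ENNReal.ofReal_le_ofReal ?_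
  have : shearDensity i₀ v x - shearDensity i₀ u x =
      (phat X x - shearDensity i₀ u x) - (phat X x - shearDensity i₀ v x) := by ring
  rw [this]
  exact abs_sub _ _

/-- Here `l` is the number of cells times the two-point bound per cell. Assouad's lemma gives `t l /
12 ≤ 2 (R + t² / 12)`, and `t = l / 4` maximises `t l / 12 - t² / 6`. The condition `M ≥ 13` ensures
`8 * M ≥ 101`. -/
theorem ofReal_sq_le_of_forall_jsRisk_le {d M n : ℕ} (hM : 13 ≤ M) (i₀ : Fin d) {τ : ℝ}
    (hτ : 0 ≤ τ) (hρ : 2 * (4 * Real.pi * (8 * M : ℕ) * τ) ≤ (1 / 2) ^ d / 416)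
    (hn : n * (144 * (4 * Real.pi * (8 * M : ℕ) * τ) ^ 2 * (1 / ((8 * M : ℕ) : ℝ)) ^ d) ≤ 1 / 2)
    {phat : (Fin n → EuclideanSpace ℝ (Fin d)) → EuclideanSpace ℝ (Fin d) → ℝ}
    (hphat : IsDensityEstimator phat) {R : ℝ≥0∞}
    (hR : ∀ u, IsShearPerturbation (8 * M) i₀ τ u → jsRisk phat (shearDensity i₀ u) ≤ R) :
    ENNReal.ofReal ((4 * Real.pi * (8 * M : ℕ) * τ * ((1 / 384) ^ d / 8000)) ^ 2 / 192) ≤ R := by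
  have hM0 : 0 < M := by omega
  have hMr : (0 : ℝ) < M := by exact_mod_cast hM0
  set ρ := 4 * Real.pi * (8 * M : ℕ) * τ with hρdef
  have hρ0 : 0 ≤ ρ := by positivity
  have hpow : (1 / 2 : ℝ) ^ d ≤ 1 := pow_le_one₀ (by norm_num) (by norm_num)
  have hu := fun s => isShearPerturbation_waveSum (d := d) hM0 i₀ hτ (by linarith) s
  set l := ρ * ((1 / 384) ^ d / 8000) with hl
  have hl0 : 0 ≤ l := by positivity
  have h1 := mul_card_mul_le_of_hypercube (J := Fin d → Fin M)
    (fun j s => ∫⁻ X, (∫⁻ x in gridCell (8 * M) (gridCenter M j),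
      ENNReal.ofReal |phat X x - shearDensity i₀ (waveSum i₀ τ s) x|)
        ∂(Measure.pi fun _ : Fin n => densityMeasure (shearDensity i₀ (waveSum i₀ τ s))))
    (fun j s => half_le_lintegral_add_lintegral_shear (hu s)
      (hu (Function.update s j (!s j))) (a := if s j then -τ else τ)
      (by split_ifs <;> simp [abs_of_nonneg hτ]) (waveSum_update i₀ τ s j) (by omega)
      (gridCenter_mem hM0 j i₀) hρ hn hphat.measurable)
    (R := R + ENNReal.ofReal ((l / 4) ^ 2 / 12)) (t := ENNReal.ofReal (l / 4 / 12))
    (fun s => (ofReal_mul_sum_lintegral_le_jsRisk hphat (hu s).measurable_shearDensity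
      (hu s).isCubeDensity (hu s).shearDensity_pos
      (fun j => measurableSet_gridCell (8 * M) (gridCenter M j)) (pairwise_disjoint_gridCell hM0)
      (gridCell_subset hM0) (by positivity)).trans (by gcongr; exact hR _ (hu s)))
  have h2 : (Fintype.card (Fin d → Fin M) : ℝ≥0∞) * (2⁻¹ * ENNReal.ofReal
      (4 * Real.pi * (8 * M : ℕ) * τ * (1 / 2) ^ d / 4000 * (1 / (24 * (8 * M : ℕ) : ℝ)) ^ d)) =
      ENNReal.ofReal l := by
    have e1 : (Fintype.card (Fin d → Fin M) : ℝ≥0∞) = ENNReal.ofReal ((M : ℝ) ^ d) := by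
      rw [Fintype.card_fun, Fintype.card_fin, Fintype.card_fin, ENNReal.ofReal_pow hMr.le,
        ENNReal.ofReal_natCast]
      push_cast; rfl
    have e2 : (2⁻¹ : ℝ≥0∞) = ENNReal.ofReal (1 / 2) := by
      rw [one_div, ENNReal.ofReal_inv_of_pos (by norm_num)]; norm_num
    rw [e1, e2, ← ENNReal.ofReal_mul (by norm_num), ← ENNReal.ofReal_mul (by positivity), hl,
      ← hρdef]
    congr 1
    -- The `M ^ d` cells compensate the volume of a steep box: `384 = 2 * 24 * 8`.
    have e3 : (1 / 384 : ℝ) ^ d = (M : ℝ) ^ d * ((1 / 2) ^ d * (1 / (24 * (8 * M : ℕ) : ℝ)) ^ d) := by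
      rw [← mul_pow, ← mul_pow]
      congr 1
      push_cast
      field_simp
      norm_num
    rw [e3]
    ring
  rw [h2, ← ENNReal.ofReal_mul (by positivity), mul_add, two_mul (ENNReal.ofReal _),
    ← ENNReal.ofReal_add (by positivity) (by positivity)] at h1
  have h3 : l / 4 / 12 * l = l ^ 2 / 96 + ((l / 4) ^ 2 / 12 + (l / 4) ^ 2 / 12) := by ring
  rw [h3, ENNReal.ofReal_add (by positivity) (by positivity)] at h1
  have h4 := (ENNReal.add_le_add_iff_right ENNReal.ofReal_ne_top).1 h1
  have h5 : l ^ 2 / 96 = 2 * (l ^ 2 / 192) := by ring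
  rw [h5, ENNReal.ofReal_mul (by norm_num), ENNReal.ofReal_ofNat] at h4
  exact (ENNReal.mul_le_mul_iff_right (by simp) (by simp)).1 h4

theorem theorem3 (d : ℕ) (hd : 1 ≤ d) (Λ : ℝ) (hΛ : 1 < Λ) :
    ∃ c : ℝ, 0 < c ∧ ∀ β : ℝ, 2 < β → ∀ H : ℝ, 1 < H → ∃ n₀ : ℕ, ∀ n : ℕ, n₀ ≤ n →
      ∀ phat : (Fin n → EuclideanSpace ℝ (Fin d)) → EuclideanSpace ℝ (Fin d) → ℝ,
        IsDensityEstimator phat →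
        ENNReal.ofReal (c * (n : ℝ) ^ (-(2 * β / (2 * β + (d : ℝ))))) ≤
          ⨆ p ∈ smoothTransportDensities d β Λ H, jsRisk phat p := by
  have hdr : (1 : ℝ) ≤ d := by exact_mod_cast hd
  have hpi := Real.pi_gt_three
  -- The amplitude constant has to satisfy `2 d c₀ ≤ 1` for the Hölder condition and `144 c₀² (8π)^d
  -- ≤ 1/2` for indistinguishability. It depends on `d` only.
  set c₀ : ℝ := 1 / (32 * d * (8 * Real.pi) ^ d) with hc₀
  have hc₀0 : 0 < c₀ := by positivity
  have hpi8 : (1 : ℝ) ≤ (8 * Real.pi) ^ d := one_le_pow₀ (by linarith)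
  have hc₀d : 32 * d * c₀ ≤ 1 := by
    rw [hc₀, mul_one_div, div_le_one (by positivity)]
    exact le_mul_of_one_le_right (by positivity) hpi8
  have hc₀p : 32 * (c₀ * (8 * Real.pi) ^ d) ≤ 1 := by
    have : 32 * (c₀ * (8 * Real.pi) ^ d) = 1 / d := by rw [hc₀]; field_simp
    rw [this, div_le_one (by linarith)]
    exact hdr
  clear_value c₀
  set k : ℝ := (1 / 384) ^ d / 8000 with hk
  have hk0 : 0 < k := by positivity
  clear_value k
  refine ⟨(c₀ * k) ^ 2 / 192, by positivity, fun β hβ H hH => ?_⟩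
  set ex : ℝ := 1 / (2 * β + d) with hex
  have hden : 0 < 2 * β + d := by positivity
  have hex0 : 0 < ex := by positivity
  have hr : Filter.Tendsto (fun n : ℕ => (n : ℝ) ^ ex) Filter.atTop Filter.atTop :=
    (tendsto_rpow_atTop hex0).comp tendsto_natCast_atTop_atTop
  have hrβ : Filter.Tendsto (fun n : ℕ => c₀ * ((n : ℝ) ^ ex) ^ (-β)) Filter.atTop (nhds 0) := by
    simpa using ((tendsto_rpow_neg_atTop (by linarith : 0 < β)).comp hr).const_mul c₀
  have hΛ1 : Λ⁻¹ < 1 := inv_lt_one_of_one_lt₀ hΛ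
  -- All constraints involving `Λ` and `H` are upper bounds on the slope `ρ`, which tends to `0`;
  -- they affect `n₀` but not the constant.
  obtain ⟨η, hη0, hη⟩ : ∃ η : ℝ, 0 < η ∧ ∀ ρ ≤ η, 2 * ρ ≤ (1 / 2) ^ d / 416 ∧ 1 + ρ ≤ H ∧
      Λ⁻¹ ≤ 1 - d * ρ ∧ 1 + d * ρ ≤ Λ := by
    refine ⟨min (min ((1 / 2) ^ d / 832) (H - 1)) (min ((1 - Λ⁻¹) / d) ((Λ - 1) / d)), ?_, ?_⟩
    · refine lt_min (lt_min (by positivity) (by linarith)) (lt_min ?_ ?_)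
      · exact div_pos (by linarith) (by linarith)
      · exact div_pos (by linarith) (by linarith)
    · intro ρ h
      rw [le_min_iff, le_min_iff, le_min_iff] at h
      obtain ⟨⟨h1, h2⟩, h3, h4⟩ := h
      rw [le_div_iff₀' (by linarith)] at h3 h4
      refine ⟨by linarith, by linarith, by linarith, by linarith⟩
  obtain ⟨n₀, hn₀⟩ := Filter.eventually_atTop.1 ((hr.eventually_ge_atTop (32 * Real.pi * 13)).and
    ((hrβ.eventually_lt_const hη0).and (Filter.eventually_ge_atTop 1)))
  refine ⟨n₀, fun n hn phat hphat => ?_⟩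
  obtain ⟨hr1, hr2, hn1⟩ := hn₀ n hn
  have hnr : (1 : ℝ) ≤ n := by exact_mod_cast hn1
  set r : ℝ := (n : ℝ) ^ ex with hrdef
  have hr0 : 0 < r := by positivity
  set M : ℕ := ⌊r / (32 * Real.pi)⌋₊ with hMdef
  have hM13 : 13 ≤ M := by
    refine Nat.le_floor ?_
    rw [le_div_iff₀ (by positivity)]
    push_cast
    linarith
  have hMle : (M : ℝ) ≤ r / (32 * Real.pi) := Nat.floor_le (by positivity)
  have hMlt : r / (32 * Real.pi) < M + 1 := Nat.lt_floor_add_one _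
  have hM13r : (13 : ℝ) ≤ M := by exact_mod_cast hM13
  have hM0 : (0 : ℝ) < M := by linarith
  set A : ℝ := 4 * Real.pi * (8 * M : ℕ) with hA
  have hA0 : 0 < A := by positivity
  -- The divisor `32π` in `M` is chosen for this: `A` is raised to the power `β`, so a bound by a
  -- larger multiple of `r` would bring `β` into the constant.
  have hAr : A ≤ r := by
    rw [le_div_iff₀ (by positivity)] at hMle
    rw [hA]; push_cast; linarith
  -- Rounding down at most halves the grid size, because `M + 1 ≤ 2M`.
  have hrN : r / (8 * M : ℕ) ≤ 8 * Real.pi := by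
    rw [div_lt_iff₀ (by positivity)] at hMlt
    rw [div_le_iff₀ (by positivity)]
    push_cast
    nlinarith
  set ρ : ℝ := c₀ * r ^ (-β) with hρ
  have hρ0 : 0 < ρ := by positivity
  obtain ⟨g1, g2, g3, g4⟩ := hη ρ hr2.le
  have hAτ : A * (ρ / A) = ρ := mul_div_cancel₀ _ hA0.ne'
  have hrβ2 : r ^ β * r ^ (-β) = 1 := by
    rw [← Real.rpow_add hr0, add_neg_cancel, Real.rpow_zero]
  have hrn : (n : ℝ) = r ^ (2 * β) * r ^ d := by
    rw [← Real.rpow_natCast r d, ← Real.rpow_add hr0, hrdef, ← Real.rpow_mul (by positivity), hex,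
      one_div_mul_cancel hden.ne', Real.rpow_one]
  have hr2β : r ^ (2 * β) * (r ^ (-β)) ^ 2 = 1 := by
    have : r ^ (2 * β) = (r ^ β) ^ 2 := by
      rw [← Real.rpow_natCast, ← Real.rpow_mul hr0.le]; congr 1; push_cast; ring
    rw [this, ← mul_pow, hrβ2, one_pow]
  -- As `n = r^(2β) r^d`, the factor `r^(2β)` cancels `ρ²` and `r^d` is absorbed by `N^(-d)`.
  have hinfo : n * (144 * (A * (ρ / A)) ^ 2 * (1 / ((8 * M : ℕ) : ℝ)) ^ d) ≤ 1 / 2 := by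
    have e : n * (144 * (A * (ρ / A)) ^ 2 * (1 / ((8 * M : ℕ) : ℝ)) ^ d) =
        144 * c₀ ^ 2 * (r / (8 * M : ℕ)) ^ d * (r ^ (2 * β) * (r ^ (-β)) ^ 2) := by
      rw [hAτ, hρ, div_pow, div_pow, hrn]; ring
    rw [e, hr2β, mul_one]
    calc _ ≤ 144 * c₀ ^ 2 * (8 * Real.pi) ^ d := by gcongr
      _ = 144 * c₀ * (c₀ * (8 * Real.pi) ^ d) := by ring
      _ ≤ 144 * (1 / 32) * (1 / 32) := by
          gcongr
          · nlinarith
          · linarith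
      _ ≤ 1 / 2 := by norm_num
  have hhold : 2 * d * A ^ (1 + β) * (ρ / A) ≤ 1 := by
    calc 2 * d * A ^ (1 + β) * (ρ / A) = 2 * d * (A ^ β * ρ) := by
          rw [Real.rpow_add hA0, Real.rpow_one]; field_simp
      _ ≤ 2 * d * (r ^ β * ρ) := by
          gcongr
      _ = 2 * d * c₀ * (r ^ β * r ^ (-β)) := by rw [hρ]; ring
      _ ≤ 1 := by rw [hrβ2]; linarith
  clear_value A ρ r M
  have hR : ∀ u, IsShearPerturbation (8 * M) (⟨0, hd⟩ : Fin d) (ρ / A) u →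
      jsRisk phat (shearDensity ⟨0, hd⟩ u) ≤
        ⨆ p ∈ smoothTransportDensities d β Λ H, jsRisk phat p := by
    intro u hu
    have hmem : shearDensity ⟨0, hd⟩ u ∈ smoothTransportDensities d β Λ H := by
      refine hu.shearDensity_mem hβ ?_ ?_ hΛ ?_ ?_
      · rwa [← hA, hAτ]
      · rwa [← hA]
      · rwa [← hA, hAτ]
      · rwa [← hA, hAτ]
    exact le_iSup₂ (f := fun p (_ : p ∈ smoothTransportDensities d β Λ H) => jsRisk phat p) _ hmem
  have key := ofReal_sq_le_of_forall_jsRisk_le hM13 (⟨0, hd⟩ : Fin d) (τ := ρ / A)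
    (div_nonneg hρ0.le hA0.le) (by rw [← hA, hAτ]; exact g1) (by rw [← hA]; exact hinfo) hphat hR
  rw [← hA, hAτ, ← hk] at key
  refine le_trans (le_of_eq ?_) key
  congr 1
  have e : (n : ℝ) ^ (-(2 * β / (2 * β + (d : ℝ)))) = (r ^ (-β)) ^ 2 := by
    rw [hrdef, ← Real.rpow_natCast, ← Real.rpow_mul (by positivity),
      ← Real.rpow_mul (by positivity)]
    congr 1
    rw [hex]; push_cast; ring
  rw [e, hρ]
  ring
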